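/- Let $d\ge 3$. There is a nonempty Zariski open subset $U$ of the space of triples of forms of degree $d$ in $S=\mathbb C[x,y]$ such that for every $(f_1,f_2,f_3)\in U$ and every integer $k\ge d-2$ the following holds for $R=S/(f_1,f_2,f_3)^k$. The Hilbert series $R(t)=\sum_{i\ge 0}\dim_{\mathbb C}(R_i)\,t^i$ is $$R(t)=\sum_{i=0}^{dk-1}(i+1)t^i+\binom{d-1}{2}t^{dk}.$$ The graded Betti numbers $\beta_{i,j}$ of $R$ over $S$ (that is, $\beta_{i,j}$ is the number of generators of degree $j$ of the $i$-th free module in the minimal graded free resolution of $R$ over $S$) are $$\beta_{0,0}=1,\qquad \beta_{1,dk}=\frac{2dk-d^2+3d}{2},\qquad \beta_{2,dk+1}=dk-d^2+3d-2,\qquad \beta_{2,dk+2}=\binom{d-1}{2},$$ and $\beta_{i,j}=0$ for all other $(i,j)$. -/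

import Mathlib

open MvPolynomial

/-- The component of degree `i` of the graded ring `K[σ] ⧸ I` (for a homogeneous ideal `I`): the
classes of the forms of degree `i`. -/
noncomputable def gradedPiece {σ K : Type} [Field K] (I : Ideal (MvPolynomial σ K)) (i : ℕ) :
    Submodule K (MvPolynomial σ K ⧸ I) :=
  (homogeneousSubmodule σ K i).map (Ideal.Quotient.mkₐ K I).toLinearMap

/-- The Hilbert series `∑ dim_K (K[σ] ⧸ I)_i t ^ i`. -/
noncomputable def hilbertSeries {σ K : Type} [Field K] (I : Ideal (MvPolynomial σ K)) :
    PowerSeries ℤ :=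
  PowerSeries.mk fun i => (Module.finrank K (gradedPiece I i) : ℤ)

/-- A set of `r`-tuples of forms of degree `d` is Zariski open if it is the complement of the
common zero locus of a set `S` of polynomials in the coefficients of the forms. -/
def IsZariskiOpen {σ K : Type} [Field K] {r d : ℕ}
    (U : Set (Fin r → homogeneousSubmodule σ K d)) : Prop :=
  ∃ S : Set (MvPolynomial (Fin r × {m : σ →₀ ℕ // m.degree = d}) K),
    U = {f | ∃ p ∈ S, eval (fun v => coeff v.2.1 (f v.1 : MvPolynomial σ K)) p ≠ 0}

/-- A minimal graded free resolution `⋯ ⟶ F₂ ⟶ F₁ ⟶ F₀ ⟶ K[σ] ⧸ I ⟶ 0` by free modules of finite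
rank over the polynomial ring `K[σ]`. Here `F i` is free on a basis indexed by `Fin (rank i)`,
the basis element `l` having degree `deg i l`; it is the sum of the twists `K[σ](- deg i l)`. -/
structure MinimalGradedFreeResolution {σ K : Type} [Field K] (I : Ideal (MvPolynomial σ K)) where
  /-- The rank of `F i`. -/
  rank : ℕ → ℕ
  /-- The degrees of the basis elements of `F i`. -/
  deg : ∀ i, Fin (rank i) → ℕ
  /-- The images of the basis elements of `F 0` in `K[σ] ⧸ I`. -/
  aug : Fin (rank 0) → MvPolynomial σ K ⧸ I
  /-- The matrix of the differential `F (i + 1) ⟶ F i`. -/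
  diff : ∀ i, Matrix (Fin (rank i)) (Fin (rank (i + 1))) (MvPolynomial σ K)
  /-- The augmentation preserves degrees. -/
  aug_mem : ∀ l, aug l ∈ gradedPiece I (deg 0 l)
  /-- The differentials preserve degrees: an entry is a form of the degree that is the difference
  of the degrees of the basis elements, and is zero when this difference is negative. -/
  diff_homogeneous : ∀ i a b, diff i a b = 0 ∨
    ∃ n, deg (i + 1) b = deg i a + n ∧ (diff i a b).IsHomogeneous n
  /-- The augmentation is surjective. -/
  aug_surjective : Function.Surjective (Fintype.linearCombination (MvPolynomial σ K) aug)
  /-- Exactness at `F 0`. -/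
  exact_zero : Function.Exact (diff 0).mulVecLin
    (Fintype.linearCombination (MvPolynomial σ K) aug)
  /-- Exactness at `F (i + 1)`. -/
  exact_succ : ∀ i, Function.Exact (diff (i + 1)).mulVecLin (diff i).mulVecLin
  /-- Minimality: the image of each differential lies in `𝔪 F i`, where `𝔪` is the ideal generated
  by the variables. -/
  minimal : ∀ i a b, diff i a b ∈ Ideal.span (Set.range (X : σ → MvPolynomial σ K))

/-- `β i j` are the graded Betti numbers of `K[σ] ⧸ I`: in its minimal graded free resolution
(which is unique up to isomorphism), the `i`-th module has exactly `β i j` basis elements of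
degree `j`. -/
def HasGradedBettiNumbers {σ K : Type} [Field K] (I : Ideal (MvPolynomial σ K))
    (β : ℕ → ℕ → ℕ) : Prop :=
  ∃ F : MinimalGradedFreeResolution I, ∀ i j, β i j = Nat.card {l // F.deg i l = j}

/-! ### Forms: dimensions and homogeneous components of products. -/

section Forms

variable {σ K : Type} [Field K]

/-! Let `V_k` (`powerSpan`) be the span of the `k`-fold products of the three forms; it generates
the `k`-th power of the ideal, in degree `d * k`. For `k ≥ d - 2` two facts suffice: the variables
times `V_k` fill degree `d * k + 1` (`FillsNextDegree`), and `dim V_k = d * k + 1 - (d - 1).choose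
2` (`finrank_powerSpan`). The Hilbert series is then immediate. The dimensions of the spaces of
syzygies on a basis of `V_k` are also known, and a Koszul count (`exists_syzygy_generators`) shows
that linear and quadratic syzygies generate; their number equals the rank of the syzygy module, so
there are no second syzygies.

Both facts follow from two conditions (`IsGenericTriple`): the forms satisfy no relation of degree
`d - 1`, and filling holds for `k = d - 2`. Filling passes from `k` to `k + 1`. A relation of least
degree is a prime `F`, and every relation is a multiple of `F`: as in Bézout's theorem, an
independent relation would bound `dim V_k`, which filling forces to grow. The first condition gives
`deg F ≥ d`, and `dim V_k ≤ d * k + 1` gives `deg F ≤ d`. So `dim V_k` is a difference of binomial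
coefficients.

The two conditions are lower bounds on ranks of matrices polynomial in the coefficients, hence open.
They hold for `(x + y) ^ d, x ^ d, y ^ d`. Substituting `ζ x` for `x`, with `ζ` a `d`-th root of
unity, gives a relation too many roots (`relations_powerForms`). If `x a + y b = 0` with `a, b ∈
V_{d-3}`, then `a` vanishes at the `(d - 1) * (d - 2)` parameters of the nodes of the curve
parametrized by the forms, which exceeds its degree; a dimension count turns this injectivity into
filling for `d - 3`, hence for `d - 2`. -/

instance finite_homogeneousSubmodule [Finite σ] (n : ℕ) :
    Module.Finite K (homogeneousSubmodule σ K n) :=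
  Module.Finite.iff_fg.mpr (homogeneousSubmodule_fg σ K n)

theorem finrank_homogeneousSubmodule [Fintype σ] [DecidableEq σ] (n : ℕ) :
    Module.finrank K (homogeneousSubmodule σ K n) = (Fintype.card σ + n - 1).choose n := by
  have e : (homogeneousSubmodule σ K n) ≃ₗ[K] ({m : σ →₀ ℕ | m.degree = n} →₀ K) := by
    rw [homogeneousSubmodule_eq_finsupp_supported]
    exact AddMonoidAlgebra.supportedEquivFinsupp {m : σ →₀ ℕ | m.degree = n}
  have e2 : {m : σ →₀ ℕ | m.degree = n} ≃ Sym σ n :=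
    (Equiv.subtypeEquivRight fun m => by
      simp [Finsupp.degree_eq_sum, Finsupp.sum_fintype]).trans (Sym.equivNatSum σ n).symm
  have : Fintype {m : σ →₀ ℕ | m.degree = n} := Fintype.ofEquiv _ e2.symm
  rw [e.finrank_eq, Module.finrank_finsupp_self, Fintype.card_congr e2, Sym.card_sym_eq_choose]

theorem finrank_homogeneousSubmodule_two (n : ℕ) :
    Module.finrank K (homogeneousSubmodule (Fin 2) K n) = n + 1 := by
  rw [finrank_homogeneousSubmodule, Fintype.card_fin, show 2 + n - 1 = n + 1 by omega,
    Nat.choose_succ_self_right]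

theorem finrank_homogeneousSubmodule_three (n : ℕ) :
    Module.finrank K (homogeneousSubmodule (Fin 3) K n) = (n + 2).choose 2 := by
  rw [finrank_homogeneousSubmodule, Fintype.card_fin, show 3 + n - 1 = n + 2 by omega,
    Nat.choose_symm_add]

/-- The component of degree `m + n` of a product with a form of degree `n`. -/
theorem homogeneousComponent_mul_of_isHomogeneous {p q : MvPolynomial σ K} {n : ℕ}
    (hq : q.IsHomogeneous n) (m : ℕ) :
    homogeneousComponent (m + n) (p * q) = homogeneousComponent m p * q := by
  conv_lhs => rw [← sum_homogeneousComponent p, Finset.sum_mul, map_sum]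
  have h : ∀ i, homogeneousComponent (m + n) (homogeneousComponent i p * q) =
      if i = m then homogeneousComponent m p * q else 0 := by
    intro i
    rw [homogeneousComponent_of_mem
      ((mem_homogeneousSubmodule _ _).2 ((homogeneousComponent_isHomogeneous i p).mul hq))]
    by_cases hi : i = m
    · subst hi; simp
    · rw [if_neg (by omega), if_neg hi]
  simp only [h, Finset.sum_ite_eq', Finset.mem_range]
  split_ifs with hm
  · rfl
  · rw [homogeneousComponent_eq_zero _ _ (by omega), zero_mul]

theorem homogeneousComponent_mul_of_isHomogeneous_of_lt {p q : MvPolynomial σ K} {m n : ℕ}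
    (hq : q.IsHomogeneous n) (hm : m < n) : homogeneousComponent m (p * q) = 0 := by
  conv_lhs => rw [← sum_homogeneousComponent p, Finset.sum_mul, map_sum]
  refine Finset.sum_eq_zero fun i _ => ?_
  rw [homogeneousComponent_of_mem
    ((mem_homogeneousSubmodule _ _).2 ((homogeneousComponent_isHomogeneous i p).mul hq)),
    if_neg (by omega)]

theorem eq_zero_of_homogeneousComponent_eq_zero {p : MvPolynomial σ K}
    (h : ∀ i, homogeneousComponent i p = 0) : p = 0 := by
  rw [← sum_homogeneousComponent p]
  exact Finset.sum_eq_zero fun i _ => h i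

/-- A form of positive degree lies in the ideal generated by the variables. -/
theorem mem_span_range_X_of_isHomogeneous {p : MvPolynomial σ K} {n : ℕ}
    (hp : p.IsHomogeneous (n + 1)) :
    p ∈ Ideal.span (Set.range (X : σ → MvPolynomial σ K)) := by
  have := (Ideal.pow_le_self (n := n + 1) (I := Ideal.span (Set.range
    (X : σ → MvPolynomial σ K))) (by omega))
  apply this
  rw [Ideal.mem_span_pow_iff_exists_isHomogeneous]
  refine ⟨map C p, hp.map _, ?_⟩
  simp [eval_map, eval₂_eta]

/-- A form of positive degree in two variables is a combination of the variables. -/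
theorem exists_eq_X_mul_add_X_mul {p : MvPolynomial (Fin 2) K} {n : ℕ}
    (hp : p.IsHomogeneous (n + 1)) : ∃ q r : MvPolynomial (Fin 2) K,
      q.IsHomogeneous n ∧ r.IsHomogeneous n ∧ p = X 0 * q + X 1 * r := by
  have h := mem_span_range_X_of_isHomogeneous hp
  rw [Ideal.mem_span_range_iff_exists_fun] at h
  obtain ⟨c, hc⟩ := h
  refine ⟨homogeneousComponent n (c 0), homogeneousComponent n (c 1),
    homogeneousComponent_isHomogeneous _ _, homogeneousComponent_isHomogeneous _ _, ?_⟩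
  have := congrArg (homogeneousComponent (n + 1)) hc
  rw [homogeneousComponent_eq_self hp, Fin.sum_univ_two, map_add,
    homogeneousComponent_mul_of_isHomogeneous (isHomogeneous_X _ _),
    homogeneousComponent_mul_of_isHomogeneous (isHomogeneous_X _ _)] at this
  rw [← this, mul_comm, mul_comm (X 1)]

end Forms

theorem finrank_map_add_finrank_inf_ker {K V W : Type*} [Field K] [AddCommGroup V] [Module K V]
    [AddCommGroup W] [Module K W] (f : V →ₗ[K] W) (L : Submodule K V) [Module.Finite K L] :
    Module.finrank K (L.map f) + Module.finrank K (L ⊓ LinearMap.ker f : Submodule K V) =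
      Module.finrank K L := by
  have h := LinearMap.finrank_range_add_finrank_ker (f.domRestrict L)
  rw [LinearMap.range_domRestrict] at h
  rw [← h, ← Submodule.map_comap_subtype, LinearMap.ker_domRestrict]
  congr 1
  exact (Submodule.equivMapOfInjective L.subtype L.injective_subtype _).finrank_eq.symm

/-- The product of two submodules as a product of modules. -/
def submoduleProdEquiv {K V W : Type*} [Field K] [AddCommGroup V] [Module K V]
    [AddCommGroup W] [Module K W] (L : Submodule K V) (M : Submodule K W) :
    L.prod M ≃ₗ[K] L × M where
  toFun v := (⟨v.1.1, v.2.1⟩, ⟨v.1.2, v.2.2⟩)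
  map_add' _ _ := rfl
  map_smul' _ _ := rfl
  invFun w := ⟨(w.1.1, w.2.1), ⟨w.1.2, w.2.2⟩⟩
  left_inv _ := rfl
  right_inv _ := rfl

/-! ### Graded pieces of the syzygy module and the Koszul complex of the variables. -/

section Syzygies

variable {K : Type} [Field K]

/-- The vectors of `r` forms of degree `j` in two variables. -/
def formVectors (K : Type) [Field K] (r j : ℕ) :
    Submodule K (Fin r → MvPolynomial (Fin 2) K) where
  carrier := {v | ∀ i, (v i).IsHomogeneous j}
  add_mem' h h' i := (h i).add (h' i)
  zero_mem' _ := isHomogeneous_zero _ _ _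
  smul_mem' c v h i := by
    rw [Pi.smul_apply, smul_eq_C_mul]
    exact (h i).C_mul c

/-- Vectors of forms as a product of spaces of forms. -/
def formVectorsEquiv (K : Type) [Field K] (r j : ℕ) :
    formVectors K r j ≃ₗ[K] (Fin r → homogeneousSubmodule (Fin 2) K j) where
  toFun v i := ⟨v.1 i, v.2 i⟩
  map_add' _ _ := rfl
  map_smul' _ _ := rfl
  invFun w := ⟨fun i => (w i).1, fun i => (w i).2⟩
  left_inv _ := rfl
  right_inv _ := rfl

instance finite_formVectors (r j : ℕ) : Module.Finite K (formVectors K r j) :=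
  Module.Finite.equiv (formVectorsEquiv K r j).symm

theorem finrank_formVectors (r j : ℕ) :
    Module.finrank K (formVectors K r j) = r * (j + 1) := by
  rw [(formVectorsEquiv K r j).finrank_eq, Module.finrank_pi_fintype]
  simp [finrank_homogeneousSubmodule_two]

/-- The `K`-linear map sending a vector `v` to `∑ v i * g i`. -/
noncomputable def combination {r : ℕ} (g : Fin r → MvPolynomial (Fin 2) K) :
    (Fin r → MvPolynomial (Fin 2) K) →ₗ[K] MvPolynomial (Fin 2) K :=
  (Fintype.linearCombination (MvPolynomial (Fin 2) K) g).restrictScalars K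

theorem combination_apply {r : ℕ} (g v : Fin r → MvPolynomial (Fin 2) K) :
    combination g v = ∑ i, v i * g i := by
  simp [combination, Fintype.linearCombination_apply]

theorem combination_smul {r : ℕ} (g v : Fin r → MvPolynomial (Fin 2) K)
    (p : MvPolynomial (Fin 2) K) : combination g (p • v) = p * combination g v := by
  simp [combination_apply, Finset.mul_sum, mul_assoc]

/-- The syzygies of `g` whose entries are forms of degree `j`. -/
noncomputable def syzygies {r : ℕ} (g : Fin r → MvPolynomial (Fin 2) K) (j : ℕ) :
    Submodule K (Fin r → MvPolynomial (Fin 2) K) :=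
  formVectors K r j ⊓ LinearMap.ker (combination g)

theorem syzygies_le {r : ℕ} (g : Fin r → MvPolynomial (Fin 2) K) (j : ℕ) :
    syzygies g j ≤ formVectors K r j := inf_le_left

instance finite_syzygies {r : ℕ} (g : Fin r → MvPolynomial (Fin 2) K) (j : ℕ) :
    Module.Finite K (syzygies g j) :=
  Submodule.finiteDimensional_of_le (syzygies_le g j)

/-- The map `(z, w) ↦ x z + y w`. -/
noncomputable def mulVariables (K : Type) [Field K] (r : ℕ) :
    ((Fin r → MvPolynomial (Fin 2) K) × (Fin r → MvPolynomial (Fin 2) K)) →ₗ[K]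
      (Fin r → MvPolynomial (Fin 2) K) :=
  LinearMap.coprod (LinearMap.lsmul (MvPolynomial (Fin 2) K) _ (X 0) |>.restrictScalars K)
    (LinearMap.lsmul (MvPolynomial (Fin 2) K) _ (X 1) |>.restrictScalars K)

theorem mulVariables_apply (r : ℕ) (z w : Fin r → MvPolynomial (Fin 2) K) :
    mulVariables K r (z, w) = (X 0 : MvPolynomial (Fin 2) K) • z +
      (X 1 : MvPolynomial (Fin 2) K) • w := by
  simp [mulVariables]

/-- The map `u ↦ (y u, - x u)`. -/
noncomputable def koszulMap (K : Type) [Field K] (r : ℕ) :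
    (Fin r → MvPolynomial (Fin 2) K) →ₗ[K]
      ((Fin r → MvPolynomial (Fin 2) K) × (Fin r → MvPolynomial (Fin 2) K)) :=
  LinearMap.prod (LinearMap.lsmul (MvPolynomial (Fin 2) K) _ (X 1) |>.restrictScalars K)
    (LinearMap.lsmul (MvPolynomial (Fin 2) K) _ (-X 0) |>.restrictScalars K)

theorem koszulMap_apply (r : ℕ) (u : Fin r → MvPolynomial (Fin 2) K) :
    koszulMap K r u = ((X 1 : MvPolynomial (Fin 2) K) • u,
      -((X 0 : MvPolynomial (Fin 2) K) • u)) := by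
  ext <;> simp [koszulMap]

theorem koszulMap_injective (r : ℕ) : Function.Injective (koszulMap K r) := by
  intro u v h
  rw [koszulMap_apply, koszulMap_apply, Prod.mk.injEq] at h
  exact smul_right_injective _ (X_ne_zero (R := K) (1 : Fin 2)) h.1

theorem isHomogeneous_of_X_mul {p : MvPolynomial (Fin 2) K} {i : Fin 2} {m : ℕ}
    (h : (X i * p).IsHomogeneous (m + 1)) : p.IsHomogeneous m := by
  have h1 := homogeneousComponent_eq_self h
  rw [mul_comm, homogeneousComponent_mul_of_isHomogeneous (isHomogeneous_X _ _)] at h1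
  rw [← mul_right_cancel₀ (X_ne_zero i) h1]
  exact homogeneousComponent_isHomogeneous _ _

theorem smul_mem_syzygies {r : ℕ} {g v : Fin r → MvPolynomial (Fin 2) K} {j : ℕ}
    (hv : v ∈ syzygies g j) (i : Fin 2) :
    (X i : MvPolynomial (Fin 2) K) • v ∈ syzygies g (j + 1) := by
  refine ⟨fun l => ?_, ?_⟩
  · rw [Pi.smul_apply, smul_eq_mul, add_comm]
    exact (isHomogeneous_X _ _).mul (hv.1 l)
  · rw [SetLike.mem_coe, LinearMap.mem_ker, combination_smul, LinearMap.mem_ker.1 hv.2, mul_zero]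

theorem map_mulVariables_le {r : ℕ} (g : Fin r → MvPolynomial (Fin 2) K) (j : ℕ) :
    ((syzygies g j).prod (syzygies g j)).map (mulVariables K r) ≤ syzygies g (j + 1) := by
  rintro _ ⟨⟨z, w⟩, ⟨hz, hw⟩, rfl⟩
  rw [mulVariables_apply]
  exact add_mem (smul_mem_syzygies hz 0) (smul_mem_syzygies hw 1)

/-- Exactness of the Koszul complex: `x z = - y w` forces `y` to divide `z` because `x` and `y` are
coprime. The quotient is again a syzygy since the ring is a domain. -/
theorem syzygies_prod_inf_ker {r : ℕ} (g : Fin r → MvPolynomial (Fin 2) K) (m : ℕ) :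
    (syzygies g (m + 1)).prod (syzygies g (m + 1)) ⊓ LinearMap.ker (mulVariables K r) =
      (syzygies g m).map (koszulMap K r) := by
  apply le_antisymm
  · rintro ⟨z, w⟩ ⟨⟨hz, hw⟩, h⟩
    rw [SetLike.mem_coe, LinearMap.mem_ker, mulVariables_apply] at h
    have h1 : ∀ i, ∃ u, z i = X 1 * u := by
      intro i
      have h2 := congrFun h i
      simp only [Pi.add_apply, Pi.smul_apply, smul_eq_mul, Pi.zero_apply] at h2
      have hp : Prime (X 1 : MvPolynomial (Fin 2) K) := X_prime
      have h3 : (X 1 : MvPolynomial (Fin 2) K) ∣ X 0 * z i :=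
        ⟨-w i, by linear_combination h2⟩
      refine (hp.dvd_or_dvd h3).resolve_left ?_
      rw [X_dvd_X]
      simp
    choose u hu using h1
    have hzu : z = (X 1 : MvPolynomial (Fin 2) K) • u := funext hu
    refine ⟨u, ⟨fun i => isHomogeneous_of_X_mul (i := 1) (hu i ▸ hz.1 i), ?_⟩, ?_⟩
    · have h4 := LinearMap.mem_ker.1 hz.2
      rw [hzu, combination_smul] at h4
      exact LinearMap.mem_ker.2 ((mul_eq_zero.1 h4).resolve_left (X_ne_zero _))
    · rw [koszulMap_apply, ← hzu]
      refine Prod.ext rfl ?_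
      apply smul_right_injective _ (X_ne_zero (R := K) (1 : Fin 2))
      simp only [smul_neg]
      rw [smul_comm, ← hzu]
      exact (eq_neg_of_add_eq_zero_right h).symm
  · rintro _ ⟨u, hu, rfl⟩
    rw [koszulMap_apply]
    refine ⟨⟨smul_mem_syzygies hu 1, neg_mem (smul_mem_syzygies hu 0)⟩, ?_⟩
    rw [SetLike.mem_coe, LinearMap.mem_ker, mulVariables_apply, smul_neg, smul_comm, add_neg_cancel]

theorem finrank_map_mulVariables {r : ℕ} (g : Fin r → MvPolynomial (Fin 2) K) (m : ℕ) :
    Module.finrank K (((syzygies g (m + 1)).prod (syzygies g (m + 1))).map (mulVariables K r)) +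
      Module.finrank K (syzygies g m) = 2 * Module.finrank K (syzygies g (m + 1)) := by
  have hfin : Module.Finite K ((syzygies g (m + 1)).prod (syzygies g (m + 1))) :=
    Module.Finite.equiv (submoduleProdEquiv (syzygies g (m + 1)) (syzygies g (m + 1))).symm
  have h := finrank_map_add_finrank_inf_ker (mulVariables K r)
    ((syzygies g (m + 1)).prod (syzygies g (m + 1)))
  rw [syzygies_prod_inf_ker, ← (Submodule.equivMapOfInjective _ (koszulMap_injective r) _).finrank_eq,
    (submoduleProdEquiv (syzygies g (m + 1)) (syzygies g (m + 1))).finrank_eq,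
    Module.finrank_prod] at h
  omega

end Syzygies

/-! ### Generators of the syzygy module. -/

section Resolution

variable {K : Type} [Field K] {n r : ℕ} {g : Fin r → MvPolynomial (Fin 2) K}

theorem map_combination_formVectors_zero (g : Fin r → MvPolynomial (Fin 2) K) :
    (formVectors K r 0).map (combination g) = Submodule.span K (Set.range g) := by
  apply le_antisymm
  · rintro _ ⟨v, hv, rfl⟩
    rw [combination_apply]
    refine Submodule.sum_mem _ fun i _ => ?_
    obtain ⟨c, hc⟩ : ∃ c, v i = C c :=
      ⟨_, totalDegree_eq_zero_iff_eq_C.1 (Nat.le_zero.1 (hv i).totalDegree_le)⟩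
    rw [hc, ← smul_eq_C_mul]
    exact Submodule.smul_mem _ _ (Submodule.subset_span ⟨i, rfl⟩)
  · rw [Submodule.span_le]
    rintro _ ⟨i, rfl⟩
    refine ⟨Pi.single i 1, fun j => ?_, ?_⟩
    · rcases eq_or_ne j i with rfl | h
      · rw [Pi.single_eq_same]; exact isHomogeneous_one _ _
      · rw [Pi.single_eq_of_ne h]; exact isHomogeneous_zero _ _ _
    · simp [combination_apply, Pi.single_apply]

theorem combination_mem {v : Fin r → MvPolynomial (Fin 2) K} (hg : ∀ i, (g i).IsHomogeneous n)
    {j : ℕ} (hv : v ∈ formVectors K r j) : (combination g v).IsHomogeneous (n + j) := by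
  rw [combination_apply]
  refine IsHomogeneous.sum _ _ _ fun i _ => ?_
  rw [add_comm]
  exact (hv i).mul (hg i)

theorem smul_mem_formVectors {v : Fin r → MvPolynomial (Fin 2) K} {j : ℕ}
    (hv : v ∈ formVectors K r j) (i : Fin 2) :
    (X i : MvPolynomial (Fin 2) K) • v ∈ formVectors K r (j + 1) := fun l => by
  rw [Pi.smul_apply, smul_eq_mul, add_comm]
  exact (isHomogeneous_X _ _).mul (hv l)

/-- If the variables times the span of the forms `g` of degree `n` fill up degree `n + 1`, then the
ideal generated by `g` fills up every degree above `n`. -/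
theorem exists_combination_eq
    (hgen : ∀ p : MvPolynomial (Fin 2) K, p.IsHomogeneous (n + 1) →
      ∃ a ∈ Submodule.span K (Set.range g), ∃ b ∈ Submodule.span K (Set.range g),
        p = X 0 * a + X 1 * b) (j : ℕ) :
    ∀ p : MvPolynomial (Fin 2) K, p.IsHomogeneous (n + (j + 1)) →
      ∃ v ∈ formVectors K r (j + 1), combination g v = p := by
  induction j with
  | zero =>
    intro p hp
    obtain ⟨a, ha, b, hb, rfl⟩ := hgen p hp
    rw [← map_combination_formVectors_zero] at ha hb
    obtain ⟨v, hv, rfl⟩ := ha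
    obtain ⟨w, hw, rfl⟩ := hb
    exact ⟨_, add_mem (smul_mem_formVectors hv 0) (smul_mem_formVectors hw 1), by
      rw [map_add, combination_smul, combination_smul]⟩
  | succ j ih =>
    intro p hp
    obtain ⟨a, b, ha, hb, rfl⟩ := exists_eq_X_mul_add_X_mul (n := n + (j + 1)) hp
    obtain ⟨v, hv, rfl⟩ := ih a ha
    obtain ⟨w, hw, rfl⟩ := ih b hb
    exact ⟨_, add_mem (smul_mem_formVectors hv 0) (smul_mem_formVectors hw 1), by
      rw [map_add, combination_smul, combination_smul]⟩

/-- Rank-nullity, since the forms `g` generate everything in degree `n + j + 1`. The dimension is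
affine in `j`, and this is what makes the Koszul count close up. The formula starts at entries of
degree `1`; for constant entries linear independence gives zero instead. -/
theorem finrank_syzygies (hg : ∀ i, (g i).IsHomogeneous n)
    (hgen : ∀ p : MvPolynomial (Fin 2) K, p.IsHomogeneous (n + 1) →
      ∃ a ∈ Submodule.span K (Set.range g), ∃ b ∈ Submodule.span K (Set.range g),
        p = X 0 * a + X 1 * b) (j : ℕ) :
    (n + (j + 1) + 1) + Module.finrank K (syzygies g (j + 1)) = r * (j + 2) := by
  have h := finrank_map_add_finrank_inf_ker (combination g) (formVectors K r (j + 1))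
  have hmap : (formVectors K r (j + 1)).map (combination g) =
      homogeneousSubmodule (Fin 2) K (n + (j + 1)) := by
    apply le_antisymm
    · rintro _ ⟨v, hv, rfl⟩
      exact combination_mem hg hv
    · intro p hp
      exact exists_combination_eq hgen j p hp
  rw [hmap, finrank_homogeneousSubmodule_two, finrank_formVectors] at h
  exact h

theorem syzygies_zero (hli : LinearIndependent K g) : syzygies g 0 = ⊥ := by
  rw [eq_bot_iff]
  rintro v ⟨hv, hv'⟩
  have h : ∀ i, v i = C (coeff 0 (v i)) := fun i =>
    totalDegree_eq_zero_iff_eq_C.1 (Nat.le_zero.1 (hv i).totalDegree_le)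
  rw [SetLike.mem_coe, LinearMap.mem_ker, combination_apply] at hv'
  have h2 : ∑ i, coeff 0 (v i) • g i = 0 := by
    rw [← hv']
    refine Finset.sum_congr rfl fun i _ => ?_
    rw [h i, ← smul_eq_C_mul, coeff_zero_C]
  have h3 := Fintype.linearIndependent_iff.1 hli _ h2
  rw [Submodule.mem_bot]
  funext i
  rw [h i, h3 i, map_zero, Pi.zero_apply]

/-- Homogeneous generators of the module of syzygies. -/
theorem exists_syzygy_generators {a b : ℕ} (ha : a = 2 * r - (n + 2)) (hb : b = n + 1 - r)
    (hg : ∀ i, (g i).IsHomogeneous n) (hli : LinearIndependent K g)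
    (hgen : ∀ p : MvPolynomial (Fin 2) K, p.IsHomogeneous (n + 1) →
      ∃ a ∈ Submodule.span K (Set.range g), ∃ b ∈ Submodule.span K (Set.range g),
        p = X 0 * a + X 1 * b) :
    ∃ (z : Fin a → Fin r → MvPolynomial (Fin 2) K) (w : Fin b → Fin r → MvPolynomial (Fin 2) K),
      (∀ i, z i ∈ syzygies g 1) ∧ (∀ i, w i ∈ syzygies g 2) ∧
      ∀ j, syzygies g j ≤ (Submodule.span (MvPolynomial (Fin 2) K)
        (Set.range z ∪ Set.range w)).restrictScalars K := by
  have h1 : n + 1 + 1 + Module.finrank K (syzygies g 1) = r * 2 := finrank_syzygies hg hgen 0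
  have h2 : n + 2 + 1 + Module.finrank K (syzygies g 2) = r * 3 := finrank_syzygies hg hgen 1
  have hM : Module.finrank K (((syzygies g 1).prod (syzygies g 1)).map (mulVariables K r)) +
    Module.finrank K (syzygies g 0) = 2 * Module.finrank K (syzygies g 1) :=
    finrank_map_mulVariables g 0
  set M := ((syzygies g 1).prod (syzygies g 1)).map (mulVariables K r) with hMdef
  have hle : M ≤ syzygies g 2 := map_mulVariables_le g 1
  rw [syzygies_zero hli, finrank_bot] at hM
  -- A complement of the multiples of linear syzygies inside the quadratic ones gives the new
  -- generators. Its dimension is `(3 * r - n - 3) - 2 * (2 * r - n - 2) = n + 1 - r`.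
  obtain ⟨D, hD⟩ := Submodule.exists_isCompl M
  have hsup : M ⊔ (D ⊓ syzygies g 2) = syzygies g 2 := by
    rw [← sup_inf_assoc_of_le _ hle, hD.sup_eq_top, top_inf_eq]
  have hinf : M ⊓ (D ⊓ syzygies g 2) = ⊥ := by
    rw [← inf_assoc, hD.inf_eq_bot, bot_inf_eq]
  have hMfin : Module.Finite K M := Submodule.finiteDimensional_of_le hle
  have hDfin : Module.Finite K (D ⊓ syzygies g 2 : Submodule K _) :=
    Submodule.finiteDimensional_of_le inf_le_right
  have h3 := Submodule.finrank_sup_add_finrank_inf_eq M (D ⊓ syzygies g 2)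
  rw [hsup, hinf, finrank_bot] at h3
  let bz := Module.finBasisOfFinrankEq K (syzygies g 1) (n := a) (by omega)
  let bw := Module.finBasisOfFinrankEq K (D ⊓ syzygies g 2 : Submodule K _) (n := b)
    (by omega)
  set N := (Submodule.span (MvPolynomial (Fin 2) K)
        (Set.range (fun i => (bz i).1) ∪ Set.range (fun i => (bw i).1))) with hN
  have key : ∀ (L : Submodule K (Fin r → MvPolynomial (Fin 2) K)) (m : ℕ)
      (b : Module.Basis (Fin m) K L), (∀ i, (b i).1 ∈ N) → L ≤ N.restrictScalars K := by
    intro L m b hb v hv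
    have := congrArg Subtype.val (b.sum_repr ⟨v, hv⟩)
    simp only [Submodule.coe_sum, Submodule.coe_smul] at this
    rw [← this]
    exact Submodule.sum_mem _ fun i _ => Submodule.smul_mem _ _ (hb i)
  have hN1 : syzygies g 1 ≤ N.restrictScalars K :=
    key _ _ bz fun i => Submodule.subset_span (Or.inl ⟨i, rfl⟩)
  have hstep : ∀ j, syzygies g j ≤ N.restrictScalars K →
      ((syzygies g j).prod (syzygies g j)).map (mulVariables K r) ≤ N.restrictScalars K := by
    rintro j hj _ ⟨⟨u, v⟩, ⟨hu, hv⟩, rfl⟩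
    rw [mulVariables_apply]
    exact N.add_mem (N.smul_mem _ (hj hu)) (N.smul_mem _ (hj hv))
  have hN2 : syzygies g 2 ≤ N.restrictScalars K := by
    rw [← hsup]
    exact sup_le (hstep 1 hN1) (key _ _ bw fun i => Submodule.subset_span (Or.inr ⟨i, rfl⟩))
  have hN3 : ∀ j, syzygies g (j + 2) ≤ N.restrictScalars K := by
    intro j
    induction j with
    | zero => exact hN2
    | succ j ih =>
      -- From here on no new generators occur: the Koszul count gives the image dimension `2 * s (j
      -- + 2) - s (j + 1)`, where `s` is the dimension of the syzygies, and this is `s (j + 3)`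
      -- because `s` is affine from degree `1` on.
      refine le_trans (le_of_eq ?_) (hstep (j + 2) ih)
      refine (Submodule.eq_of_le_of_finrank_eq (map_mulVariables_le g (j + 2)) ?_).symm
      have e1 := finrank_map_mulVariables g (j + 1)
      have e2 : n + (j + 1) + 1 + Module.finrank K (syzygies g (j + 1)) = r * (j + 2) :=
        finrank_syzygies hg hgen j
      have e3 : n + (j + 2) + 1 + Module.finrank K (syzygies g (j + 2)) = r * (j + 3) :=
        finrank_syzygies hg hgen (j + 1)
      have e4 : n + (j + 3) + 1 + Module.finrank K (syzygies g (j + 3)) = r * (j + 4) :=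
        finrank_syzygies hg hgen (j + 2)
      have e5 : r * (j + 2) + r * (j + 4) = 2 * (r * (j + 3)) := by ring
      change Module.finrank K (((syzygies g (j + 2)).prod (syzygies g (j + 2))).map
        (mulVariables K r)) = Module.finrank K (syzygies g (j + 3))
      change Module.finrank K (((syzygies g (j + 2)).prod (syzygies g (j + 2))).map
        (mulVariables K r)) + Module.finrank K (syzygies g (j + 1)) =
          2 * Module.finrank K (syzygies g (j + 2)) at e1
      omega
  refine ⟨fun i => (bz i).1, fun i => (bw i).1, fun i => (bz i).2, fun i => (bw i).2.2, ?_⟩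
  intro j
  match j with
  | 0 => rw [syzygies_zero hli]; exact bot_le
  | 1 => exact hN1
  | j + 2 => exact hN3 j

/-- A submodule containing all the homogeneous syzygies contains all the syzygies. -/
theorem mem_of_syzygies_le (hg : ∀ i, (g i).IsHomogeneous n)
    {N : Submodule K (Fin r → MvPolynomial (Fin 2) K)} (hN : ∀ j, syzygies g j ≤ N)
    {v : Fin r → MvPolynomial (Fin 2) K} (hv : combination g v = 0) : v ∈ N := by
  have hv' : v = ∑ j ∈ Finset.range (Finset.univ.sup (fun i => (v i).totalDegree) + 1),
      fun i => homogeneousComponent j (v i) := by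
    funext i
    rw [Finset.sum_apply]
    conv_lhs => rw [← sum_homogeneousComponent (v i)]
    refine Finset.sum_subset ?_ fun j _ hj => ?_
    · intro j hj
      rw [Finset.mem_range] at hj ⊢
      have := Finset.le_sup (f := fun i => (v i).totalDegree) (Finset.mem_univ i)
      omega
    · rw [Finset.mem_range] at hj
      exact homogeneousComponent_eq_zero _ _ (by omega)
  rw [hv']
  refine Submodule.sum_mem _ fun j _ => hN j ⟨fun i => homogeneousComponent_isHomogeneous _ _, ?_⟩
  rw [SetLike.mem_coe, LinearMap.mem_ker, combination_apply]
  rw [combination_apply] at hv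
  have := congrArg (homogeneousComponent (j + n)) hv
  rw [map_sum, map_zero] at this
  rw [← this]
  exact Finset.sum_congr rfl fun i _ => (homogeneousComponent_mul_of_isHomogeneous (hg i) j).symm

end Resolution

/-! ### The free resolution of length two and its Betti numbers. -/

section Resolution

/-- A linear map from a free module onto the kernel of a linear form `S ^ r → S` is injective if
the rank of its source is `r - 1`. -/
theorem injective_of_range_eq_ker {S : Type*} [CommRing S] [IsDomain S] [IsNoetherianRing S]
    {m r : ℕ} (φ : (Fin m → S) →ₗ[S] (Fin r → S)) (ψ : (Fin r → S) →ₗ[S] S)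
    (h : LinearMap.range φ = LinearMap.ker ψ) (hm : m + 1 = r) : Function.Injective φ := by
  have h1 := (LinearMap.ker φ).finrank_quotient_add_finrank
  have h2 := (LinearMap.ker ψ).finrank_quotient_add_finrank
  rw [φ.quotKerEquivRange.finrank_eq] at h1
  rw [ψ.quotKerEquivRange.finrank_eq] at h2
  have h3 : Module.finrank S (LinearMap.range ψ) ≤ 1 := by
    -- An ideal has rank at most one, so the kernel of `ψ` has rank at least `r - 1 = m`. Nothing is
    -- left for the kernel of `φ`, and a submodule of rank zero in a free module over a domain is
    -- zero.
    simpa using Submodule.finrank_le (LinearMap.range ψ)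
  rw [h, Module.finrank_fin_fun] at h1
  rw [Module.finrank_fin_fun] at h2
  have h4 : Module.finrank S (LinearMap.ker φ) = 0 := by omega
  rw [← LinearMap.ker_eq_bot, ← Submodule.rank_eq_zero, ← Submodule.finrank_eq_rank, h4,
    Nat.cast_zero]

variable {K : Type} [Field K] {n r m : ℕ} {g : Fin r → MvPolynomial (Fin 2) K}

section Exactness

variable {S : Type*} [CommRing S]

theorem linearCombination_one_quotient (I : Ideal S) (y : Fin 1 → S) :
    Fintype.linearCombination S (fun _ : Fin 1 => (1 : S ⧸ I)) y = Ideal.Quotient.mk I (y 0) := by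
  rw [Fintype.linearCombination_apply, Fin.sum_univ_one]
  change Ideal.Quotient.mk I (y 0 * 1) = _
  rw [mul_one]

theorem row_mulVecLin_apply {r : ℕ} (g v : Fin r → S) (i : Fin 1) :
    (Matrix.of fun (_ : Fin 1) l => g l).mulVecLin v i = ∑ l, v l * g l := by
  rw [Matrix.mulVecLin_apply, Matrix.mulVec, dotProduct]
  exact Finset.sum_congr rfl fun _ _ => mul_comm _ _

theorem exact_row_quotient {r : ℕ} (g : Fin r → S) :
    Function.Exact (Matrix.of fun (_ : Fin 1) l => g l).mulVecLin
      (Fintype.linearCombination S fun _ : Fin 1 => (1 : S ⧸ Ideal.span (Set.range g))) := by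
  intro y
  rw [linearCombination_one_quotient, Ideal.Quotient.eq_zero_iff_mem,
    Ideal.mem_span_range_iff_exists_fun]
  refine exists_congr fun c => ⟨fun h => ?_, fun h => ?_⟩
  · funext i
    rw [row_mulVecLin_apply, h, Subsingleton.elim i 0]
  · rw [← h, row_mulVecLin_apply]

theorem exact_row_of_range_eq_ker {r m : ℕ} {g : Fin r → S} {D : Matrix (Fin r) (Fin m) S}
    (h : LinearMap.range D.mulVecLin = LinearMap.ker (Fintype.linearCombination S g)) :
    Function.Exact D.mulVecLin (Matrix.of fun (_ : Fin 1) l => g l).mulVecLin := by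
  intro y
  rw [← LinearMap.coe_range, SetLike.mem_coe, h, LinearMap.mem_ker,
    Fintype.linearCombination_apply, funext_iff]
  simp only [row_mulVecLin_apply, Pi.zero_apply, forall_const, smul_eq_mul]

theorem exact_zero_of_injective {r m : ℕ} {D : Matrix (Fin r) (Fin m) S}
    (h : Function.Injective D.mulVecLin) :
    Function.Exact (0 : Matrix (Fin m) (Fin 0) S).mulVecLin D.mulVecLin := by
  intro y
  rw [Matrix.mulVecLin_zero, map_eq_zero_iff _ h]
  simp [eq_comm]

theorem exact_of_subsingleton {M N P : Type*} [Subsingleton N] [Nonempty M] [Zero P] (f : M → N)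
    (g : N → P) (h : ∀ x, g x = 0) : Function.Exact f g := fun y =>
  ⟨fun _ => ⟨Classical.arbitrary M, Subsingleton.elim _ _⟩, fun _ => h y⟩

end Exactness

/-- The ranks of the modules in a resolution of length two of a cyclic module. -/
def lengthTwoRank (r m : ℕ) : ℕ → ℕ
  | 0 => 1
  | 1 => r
  | 2 => m
  | _ + 3 => 0

/-- The minimal resolution of length two of the quotient by an ideal generated by forms `g` of
degree `n` whose module of syzygies is free on the columns of the matrix `D`. -/
noncomputable def lengthTwoResolution (hn : 0 < n) (hg : ∀ i, (g i).IsHomogeneous n)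
    (D : Matrix (Fin r) (Fin m) (MvPolynomial (Fin 2) K)) (e : Fin m → ℕ)
    (hD : ∀ i l, ∃ t, e l = n + (t + 1) ∧ (D i l).IsHomogeneous (t + 1))
    (hrange : LinearMap.range D.mulVecLin =
      LinearMap.ker (Fintype.linearCombination (MvPolynomial (Fin 2) K) g))
    (hinj : Function.Injective D.mulVecLin) :
    MinimalGradedFreeResolution (Ideal.span (Set.range g)) where
  rank := lengthTwoRank r m
  deg
    | 0 => fun _ => 0
    | 1 => fun _ => n
    | 2 => e
    | _ + 3 => fun _ => 0
  aug _ := 1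
  diff
    | 0 => Matrix.of fun _ l => g l
    | 1 => D
    | _ + 2 => 0
  aug_mem _ := ⟨1, isHomogeneous_one _ _, rfl⟩
  diff_homogeneous
    | 0 => fun _ l => Or.inr ⟨n, (zero_add n).symm, hg l⟩
    | 1 => fun i l => let ⟨t, h1, h2⟩ := hD i l; Or.inr ⟨t + 1, h1, h2⟩
    | _ + 2 => fun _ l => l.elim0
  aug_surjective q := by
    obtain ⟨p, rfl⟩ := Ideal.Quotient.mk_surjective q
    exact ⟨fun _ => p, linearCombination_one_quotient _ _⟩
  exact_zero := exact_row_quotient g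
  exact_succ
    | 0 => exact_row_of_range_eq_ker hrange
    | 1 => exact_zero_of_injective hinj
    | _ + 2 => exact_of_subsingleton (N := Fin 0 → MvPolynomial (Fin 2) K) _ _ fun y => by
        rw [Subsingleton.elim y 0]
        exact map_zero _
  minimal
    | 0 => fun _ l => by
      obtain ⟨t, rfl⟩ := Nat.exists_eq_succ_of_ne_zero hn.ne'
      exact mem_span_range_X_of_isHomogeneous (hg l)
    | 1 => fun i l => let ⟨_, _, h⟩ := hD i l; mem_span_range_X_of_isHomogeneous h
    | _ + 2 => fun _ l => l.elim0

theorem lengthTwoResolution_card (hn : 0 < n) (hg : ∀ i, (g i).IsHomogeneous n)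
    (D : Matrix (Fin r) (Fin m) (MvPolynomial (Fin 2) K)) (e : Fin m → ℕ)
    (hD : ∀ i l, ∃ t, e l = n + (t + 1) ∧ (D i l).IsHomogeneous (t + 1))
    (hrange : LinearMap.range D.mulVecLin =
      LinearMap.ker (Fintype.linearCombination (MvPolynomial (Fin 2) K) g))
    (hinj : Function.Injective D.mulVecLin) (i j : ℕ) :
    Nat.card {l // (lengthTwoResolution hn hg D e hD hrange hinj).deg i l = j} =
      if i = 0 ∧ j = 0 then 1 else if i = 1 ∧ j = n then r else
      if i = 2 then Nat.card {l // e l = j} else 0 := by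
  have hconst : ∀ m a : ℕ, Nat.card {_l : Fin m // a = j} = if j = a then m else 0 := by
    intro m a
    split_ifs with h
    · simp [h]
    · simp [Ne.symm h]
  match i with
  | 0 => exact (hconst 1 0).trans (by simp)
  | 1 => exact (hconst r n).trans (by simp)
  | 2 => exact Eq.trans rfl (by simp : Nat.card {l // e l = j} = _)
  | _ + 3 => exact (hconst 0 0).trans (by simp)

theorem card_append_const {a b c c' : ℕ} (hc : c ≠ c') (j : ℕ) :
    Nat.card {l // Fin.append (fun _ : Fin a => c) (fun _ : Fin b => c') l = j} =
      if j = c then a else if j = c' then b else 0 := by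
  rw [Nat.card_eq_fintype_card, Fintype.card_subtype, Finset.card_filter, Fin.sum_univ_add]
  simp only [Fin.append_left, Fin.append_right, Finset.sum_const, Finset.card_univ,
    Fintype.card_fin, smul_eq_mul]
  rcases eq_or_ne j c with rfl | h
  · simp [hc.symm]
  · simp [h, h.symm, eq_comm]

/-- The Betti numbers of the quotient by an ideal generated by linearly independent forms `g` of
degree `n` such that the variables times the span of `g` fill up degree `n + 1`. -/
theorem hasGradedBettiNumbers_span (hn : 0 < n) (hg : ∀ i, (g i).IsHomogeneous n)
    (hli : LinearIndependent K g)
    (hgen : ∀ p : MvPolynomial (Fin 2) K, p.IsHomogeneous (n + 1) →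
      ∃ a ∈ Submodule.span K (Set.range g), ∃ b ∈ Submodule.span K (Set.range g),
        p = X 0 * a + X 1 * b) :
    HasGradedBettiNumbers (Ideal.span (Set.range g)) fun i j =>
      if i = 0 ∧ j = 0 then 1 else if i = 1 ∧ j = n then r else
      if i = 2 then if j = n + 1 then 2 * r - (n + 2) else if j = n + 2 then n + 1 - r else 0
      else 0 := by
  obtain ⟨a, ha⟩ : ∃ a, a = 2 * r - (n + 2) := ⟨_, rfl⟩
  obtain ⟨b, hb⟩ : ∃ b, b = n + 1 - r := ⟨_, rfl⟩
  obtain ⟨z, w, hz, hw, hzw⟩ := exists_syzygy_generators ha hb hg hli hgen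
  -- Both subtractions defining `a` and `b` must be genuine: `n + 2 ≤ 2 * r` comes from the count of
  -- linear syzygies, and `r ≤ n + 1` from the independence of the forms.
  have hab : a + b + 1 = r := by
    have h1 : n + 1 + 1 + Module.finrank K (syzygies g 1) = r * 2 := finrank_syzygies hg hgen 0
    have h2 : Module.finrank K (Submodule.span K (Set.range g)) = r := by
      rw [finrank_span_eq_card hli, Fintype.card_fin]
    have h3 : Submodule.span K (Set.range g) ≤ homogeneousSubmodule (Fin 2) K n := by
      rw [Submodule.span_le]
      rintro _ ⟨i, rfl⟩
      exact hg i
    have h4 := Submodule.finrank_mono h3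
    rw [h2, finrank_homogeneousSubmodule_two] at h4
    omega
  let D : Matrix (Fin r) (Fin (a + b)) (MvPolynomial (Fin 2) K) :=
    Matrix.of fun i l => Fin.append z w l i
  have hDz : ∀ i l, D i (Fin.castAdd b l) = z l i := fun i l => by simp [D]
  have hDw : ∀ i l, D i (Fin.natAdd a l) = w l i := fun i l => by simp [D]
  have hrange : LinearMap.range D.mulVecLin =
      LinearMap.ker (Fintype.linearCombination (MvPolynomial (Fin 2) K) g) := by
    rw [Matrix.range_mulVecLin]
    have hc : Set.range D.col = Set.range z ∪ Set.range w := by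
      ext v
      constructor
      · rintro ⟨l, rfl⟩
        induction l using Fin.addCases with
        | left l => exact Or.inl ⟨l, funext fun i => (hDz i l).symm⟩
        | right l => exact Or.inr ⟨l, funext fun i => (hDw i l).symm⟩
      · rintro (⟨l, rfl⟩ | ⟨l, rfl⟩)
        · exact ⟨Fin.castAdd b l, funext fun i => hDz i l⟩
        · exact ⟨Fin.natAdd a l, funext fun i => hDw i l⟩
    rw [hc]
    apply le_antisymm
    · rw [Submodule.span_le]
      rintro _ (⟨i, rfl⟩ | ⟨i, rfl⟩)
      · exact (hz i).2
      · exact (hw i).2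
    · intro v hv
      exact mem_of_syzygies_le hg hzw hv
  have hD : ∀ i l, ∃ t, Fin.append (fun _ : Fin a => n + 1) (fun _ : Fin b => n + 2) l =
      n + (t + 1) ∧ (D i l).IsHomogeneous (t + 1) := by
    intro i l
    induction l using Fin.addCases with
    | left l => exact ⟨0, by simp, by rw [hDz]; exact (hz l).1 i⟩
    | right l => exact ⟨1, by simp, by rw [hDw]; exact (hw l).1 i⟩
  refine ⟨lengthTwoResolution hn hg D _ hD hrange (injective_of_range_eq_ker _ _ hrange hab),
    fun i j => ?_⟩
  rw [lengthTwoResolution_card, card_append_const (by omega), ha, hb]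

end Resolution

/-! ### The Hilbert series. -/

section Hilbert

variable {K : Type} [Field K] {n r : ℕ} {g : Fin r → MvPolynomial (Fin 2) K}

theorem finrank_gradedPiece_add (I : Ideal (MvPolynomial (Fin 2) K)) (i : ℕ) :
    Module.finrank K (gradedPiece I i) +
      Module.finrank K (homogeneousSubmodule (Fin 2) K i ⊓ I.restrictScalars K :
        Submodule K (MvPolynomial (Fin 2) K)) = i + 1 := by
  rw [← finrank_homogeneousSubmodule_two (K := K) i,
    ← finrank_map_add_finrank_inf_ker (Ideal.Quotient.mkₐ K I).toLinearMap
      (homogeneousSubmodule (Fin 2) K i)]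
  have h : LinearMap.ker (Ideal.Quotient.mkₐ K I).toLinearMap = I.restrictScalars K := by
    ext p
    simp [Ideal.Quotient.eq_zero_iff_mem]
  rw [h, gradedPiece]

theorem mem_span_range_iff_combination (p : MvPolynomial (Fin 2) K) :
    p ∈ Ideal.span (Set.range g) ↔ ∃ v, combination g v = p := by
  rw [Ideal.mem_span_range_iff_exists_fun]
  simp only [combination_apply]

theorem homogeneousSubmodule_inf_span_of_lt (hg : ∀ i, (g i).IsHomogeneous n) {i : ℕ}
    (hi : i < n) :
    homogeneousSubmodule (Fin 2) K i ⊓ (Ideal.span (Set.range g)).restrictScalars K = ⊥ := by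
  rw [eq_bot_iff]
  rintro p ⟨hp, hp'⟩
  obtain ⟨v, rfl⟩ := (mem_span_range_iff_combination p).1 hp'
  rw [Submodule.mem_bot, ← homogeneousComponent_eq_self hp, combination_apply, map_sum]
  exact Finset.sum_eq_zero fun l _ => homogeneousComponent_mul_of_isHomogeneous_of_lt (hg l) hi

theorem homogeneousSubmodule_inf_span_self (hg : ∀ i, (g i).IsHomogeneous n) :
    homogeneousSubmodule (Fin 2) K n ⊓ (Ideal.span (Set.range g)).restrictScalars K =
      Submodule.span K (Set.range g) := by
  apply le_antisymm
  · rintro p ⟨hp, hp'⟩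
    obtain ⟨v, rfl⟩ := (mem_span_range_iff_combination p).1 hp'
    rw [← map_combination_formVectors_zero]
    refine ⟨fun l => homogeneousComponent 0 (v l),
      fun l => homogeneousComponent_isHomogeneous _ _, ?_⟩
    rw [← homogeneousComponent_eq_self hp, combination_apply, combination_apply, map_sum]
    refine Finset.sum_congr rfl fun l _ => ?_
    have := homogeneousComponent_mul_of_isHomogeneous (p := v l) (hg l) 0
    rw [zero_add] at this
    exact this.symm
  · rw [Submodule.span_le]
    rintro _ ⟨i, rfl⟩
    exact ⟨hg i, Ideal.subset_span ⟨i, rfl⟩⟩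

theorem homogeneousSubmodule_inf_span_of_gt
    (hgen : ∀ p : MvPolynomial (Fin 2) K, p.IsHomogeneous (n + 1) →
      ∃ a ∈ Submodule.span K (Set.range g), ∃ b ∈ Submodule.span K (Set.range g),
        p = X 0 * a + X 1 * b) {i : ℕ} (hi : n < i) :
    homogeneousSubmodule (Fin 2) K i ⊓ (Ideal.span (Set.range g)).restrictScalars K =
      homogeneousSubmodule (Fin 2) K i := by
  obtain ⟨j, rfl⟩ := Nat.exists_eq_add_of_lt hi
  refine inf_eq_left.2 fun p hp => ?_
  obtain ⟨v, -, hv⟩ := exists_combination_eq hgen j p hp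
  exact (mem_span_range_iff_combination p).2 ⟨v, hv⟩

/-- The Hilbert series of the quotient by an ideal generated by linearly independent forms `g` of
degree `n` such that the variables times the span of `g` fill up degree `n + 1`. -/
theorem hilbertSeries_span (hg : ∀ i, (g i).IsHomogeneous n)
    (hli : LinearIndependent K g)
    (hgen : ∀ p : MvPolynomial (Fin 2) K, p.IsHomogeneous (n + 1) →
      ∃ a ∈ Submodule.span K (Set.range g), ∃ b ∈ Submodule.span K (Set.range g),
        p = X 0 * a + X 1 * b) {c : ℕ} (hc : r + c = n + 1) :
    hilbertSeries (Ideal.span (Set.range g)) =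
      ∑ i ∈ Finset.range n, ((i : PowerSeries ℤ) + 1) * PowerSeries.X ^ i
        + (c : PowerSeries ℤ) * PowerSeries.X ^ n := by
  ext i
  have h := finrank_gradedPiece_add (Ideal.span (Set.range g)) i
  have hcoe : ∀ (a : ℕ) (m : ℕ), PowerSeries.coeff i ((a : PowerSeries ℤ) * PowerSeries.X ^ m) =
      if i = m then (a : ℤ) else 0 := by
    intro a m
    rw [← map_natCast (PowerSeries.C (R := ℤ)), PowerSeries.coeff_C_mul, PowerSeries.coeff_X_pow]
    simp
  have hcoe' : ∀ m : ℕ, PowerSeries.coeff i (((m : PowerSeries ℤ) + 1) * PowerSeries.X ^ m) =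
      if i = m then ((m : ℤ) + 1) else 0 := by
    intro m
    have := hcoe (m + 1) m
    push_cast at this
    exact this
  rw [hilbertSeries, PowerSeries.coeff_mk, map_add, map_sum, hcoe]
  simp only [hcoe', Finset.sum_ite_eq, Finset.mem_range]
  rcases lt_trichotomy i n with hi | rfl | hi
  · rw [homogeneousSubmodule_inf_span_of_lt hg hi, finrank_bot] at h
    rw [if_pos hi, if_neg hi.ne]
    omega
  · rw [homogeneousSubmodule_inf_span_self hg, finrank_span_eq_card hli, Fintype.card_fin] at h
    rw [if_neg (lt_irrefl _), if_pos rfl]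
    omega
  · rw [homogeneousSubmodule_inf_span_of_gt hgen hi, finrank_homogeneousSubmodule_two] at h
    rw [if_neg (by omega), if_neg (by omega)]
    omega

end Hilbert

/-! ### Powers of the ideal, filling of the next degree, and relations between the forms. -/

section Relations

variable {K : Type} [Field K] {d : ℕ} {f : Fin 3 → MvPolynomial (Fin 2) K}

/-- The span of the products of `k` of the forms `f`. -/
noncomputable def powerSpan (f : Fin 3 → MvPolynomial (Fin 2) K) (k : ℕ) :
    Submodule K (MvPolynomial (Fin 2) K) :=
  (homogeneousSubmodule (Fin 3) K k).map (aeval f).toLinearMap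

/-- The relations of degree `k` between the forms `f`. -/
noncomputable def relations (f : Fin 3 → MvPolynomial (Fin 2) K) (k : ℕ) :
    Submodule K (MvPolynomial (Fin 3) K) :=
  homogeneousSubmodule (Fin 3) K k ⊓ LinearMap.ker (aeval f).toLinearMap

theorem mem_relations {k : ℕ} {P : MvPolynomial (Fin 3) K} :
    P ∈ relations f k ↔ P.IsHomogeneous k ∧ aeval f P = 0 := by
  simp [relations]

theorem mem_powerSpan {k : ℕ} {p : MvPolynomial (Fin 2) K} :
    p ∈ powerSpan f k ↔ ∃ P : MvPolynomial (Fin 3) K, P.IsHomogeneous k ∧ aeval f P = p := by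
  simp [powerSpan]

instance finite_powerSpan (f : Fin 3 → MvPolynomial (Fin 2) K) (k : ℕ) :
    Module.Finite K (powerSpan f k) :=
  inferInstanceAs (Module.Finite K ((homogeneousSubmodule (Fin 3) K k).map _))

instance finite_relations (f : Fin 3 → MvPolynomial (Fin 2) K) (k : ℕ) :
    Module.Finite K (relations f k) :=
  Submodule.finiteDimensional_of_le (S₂ := homogeneousSubmodule (Fin 3) K k) inf_le_left

theorem finrank_powerSpan_add (f : Fin 3 → MvPolynomial (Fin 2) K) (k : ℕ) :
    Module.finrank K (powerSpan f k) + Module.finrank K (relations f k) = (k + 2).choose 2 := by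
  rw [← finrank_homogeneousSubmodule_three (K := K)]
  exact finrank_map_add_finrank_inf_ker _ _

theorem isHomogeneous_aeval_forms (hf : ∀ i, (f i).IsHomogeneous d) {k : ℕ}
    {P : MvPolynomial (Fin 3) K} (hP : P.IsHomogeneous k) : (aeval f P).IsHomogeneous (d * k) :=
  hP.aeval f hf

theorem powerSpan_le (hf : ∀ i, (f i).IsHomogeneous d) (k : ℕ) :
    powerSpan f k ≤ homogeneousSubmodule (Fin 2) K (d * k) := by
  intro p hp
  obtain ⟨P, hP, rfl⟩ := mem_powerSpan.1 hp
  exact isHomogeneous_aeval_forms hf hP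

theorem mul_mem_powerSpan {k : ℕ} {p : MvPolynomial (Fin 2) K} (hp : p ∈ powerSpan f k)
    (i : Fin 3) : f i * p ∈ powerSpan f (k + 1) := by
  obtain ⟨P, hP, rfl⟩ := mem_powerSpan.1 hp
  refine mem_powerSpan.2 ⟨X i * P, ?_, by simp⟩
  rw [add_comm]
  exact (isHomogeneous_X _ _).mul hP

theorem finrank_powerSpan_le (hf : ∀ i, (f i).IsHomogeneous d) (k : ℕ) :
    Module.finrank K (powerSpan f k) ≤ d * k + 1 := by
  rw [← finrank_homogeneousSubmodule_two (K := K)]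
  exact Submodule.finrank_mono (powerSpan_le hf k)

theorem span_pow_eq_span_powerSpan (f : Fin 3 → MvPolynomial (Fin 2) K) (k : ℕ) :
    Ideal.span (Set.range f) ^ k = Ideal.span (powerSpan f k : Set (MvPolynomial (Fin 2) K)) := by
  apply le_antisymm
  · intro p hp
    obtain ⟨P, hP, rfl⟩ := (Ideal.mem_span_pow_iff_exists_isHomogeneous f p).1 hp
    rw [eval_eq']
    refine Ideal.sum_mem _ fun m hm => Ideal.mul_mem_left _ _ (Ideal.subset_span ?_)
    refine mem_powerSpan.2 ⟨monomial m 1, isHomogeneous_monomial _ ?_, ?_⟩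
    · by_contra h
      exact mem_support_iff.1 hm (hP.coeff_eq_zero h)
    · rw [aeval_monomial, map_one, one_mul, Finsupp.prod_fintype _ _ (by simp)]
  · rw [Ideal.span_le]
    intro p hp
    obtain ⟨P, hP, rfl⟩ := mem_powerSpan.1 hp
    rw [SetLike.mem_coe, Ideal.mem_span_pow_iff_exists_isHomogeneous]
    exact ⟨map C P, hP.map _, by rw [eval_map]; rfl⟩

/-- The products of `k` of the forms `f` and a variable span the forms of degree `d * k + 1`. -/
def FillsNextDegree (f : Fin 3 → MvPolynomial (Fin 2) K) (d k : ℕ) : Prop :=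
  ∀ p : MvPolynomial (Fin 2) K, p.IsHomogeneous (d * k + 1) →
    ∃ a ∈ powerSpan f k, ∃ b ∈ powerSpan f k, p = X 0 * a + X 1 * b

/-- The exponent has to be positive: only then do the products lie in the ideal of the forms. -/
theorem mem_span_range_of_fillsNextDegree {k : ℕ} (h : FillsNextDegree f d (k + 1)) (j : ℕ) :
    ∀ p : MvPolynomial (Fin 2) K, p.IsHomogeneous (d * (k + 1) + 1 + j) →
      p ∈ Ideal.span (Set.range f) := by
  induction j with
  | zero =>
    intro p hp
    have hle : ∀ a ∈ powerSpan f (k + 1), a ∈ Ideal.span (Set.range f) := fun a ha =>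
      Ideal.pow_le_self k.succ_ne_zero
        ((span_pow_eq_span_powerSpan f (k + 1)).symm ▸ Ideal.subset_span ha)
    obtain ⟨a, ha, b, hb, rfl⟩ := h p hp
    exact add_mem (Ideal.mul_mem_left _ _ (hle a ha)) (Ideal.mul_mem_left _ _ (hle b hb))
  | succ j ih =>
    intro p hp
    obtain ⟨a, b, ha, hb, rfl⟩ := exists_eq_X_mul_add_X_mul hp
    exact add_mem (Ideal.mul_mem_left _ _ (ih a ha)) (Ideal.mul_mem_left _ _ (ih b hb))

/-- A form of degree `m + d` in the ideal generated by forms of degree `d` is a combination of them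
whose coefficients are forms of degree `m`. -/
theorem exists_form_coefficients (hf : ∀ i, (f i).IsHomogeneous d) {m : ℕ}
    {p : MvPolynomial (Fin 2) K} (hp : p.IsHomogeneous (m + d))
    (hp' : p ∈ Ideal.span (Set.range f)) :
    ∃ q : Fin 3 → MvPolynomial (Fin 2) K, (∀ i, (q i).IsHomogeneous m) ∧ p = ∑ i, f i * q i := by
  obtain ⟨c, hc⟩ := Ideal.mem_span_range_iff_exists_fun.1 hp'
  refine ⟨fun i => homogeneousComponent m (c i), fun i => homogeneousComponent_isHomogeneous _ _, ?_⟩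
  rw [← homogeneousComponent_eq_self hp, ← hc, map_sum]
  exact Finset.sum_congr rfl fun i _ => by
    rw [homogeneousComponent_mul_of_isHomogeneous (hf i), mul_comm]

/-- Write a form of the new degree as `∑ f i * q i`; each `q i` has degree `d * k + 1` and can be
rewritten by `h`, and multiplication by `f i` carries `V_k` into `V_{k+1}`. -/
theorem FillsNextDegree.succ_of_mem_span (hf : ∀ i, (f i).IsHomogeneous d) {k : ℕ}
    (h : FillsNextDegree f d k)
    (hJ : ∀ p : MvPolynomial (Fin 2) K, p.IsHomogeneous (d * (k + 1) + 1) →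
      p ∈ Ideal.span (Set.range f)) : FillsNextDegree f d (k + 1) := by
  intro p hp
  obtain ⟨q, hq, rfl⟩ := exists_form_coefficients (m := d * k + 1) hf
    (by convert hp using 1; ring) (hJ p hp)
  choose a ha b hb hab using fun i => h (q i) (hq i)
  refine ⟨∑ i, f i * a i, Submodule.sum_mem _ fun i _ => mul_mem_powerSpan (ha i) i,
    ∑ i, f i * b i, Submodule.sum_mem _ fun i _ => mul_mem_powerSpan (hb i) i, ?_⟩
  rw [Finset.mul_sum, Finset.mul_sum, ← Finset.sum_add_distrib]
  exact Finset.sum_congr rfl fun i _ => by rw [hab i]; ring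

theorem FillsNextDegree.of_le (hf : ∀ i, (f i).IsHomogeneous d) {k : ℕ}
    (h : FillsNextDegree f d (k + 1)) {l : ℕ} (hl : k + 1 ≤ l) : FillsNextDegree f d l := by
  induction l, hl using Nat.le_induction with
  | base => exact h
  | succ l hl ih =>
    refine ih.succ_of_mem_span hf fun p hp => ?_
    obtain ⟨j, rfl⟩ := Nat.exists_eq_add_of_le hl
    refine mem_span_range_of_fillsNextDegree h (d * (j + 1)) p ?_
    convert hp using 1
    ring

/-- Two copies of `V_k` map onto a space of dimension `d * k + 2`. This linear growth is what
excludes a second independent relation. -/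
theorem FillsNextDegree.le_finrank {k : ℕ} (h : FillsNextDegree f d k) :
    d * k + 2 ≤ 2 * Module.finrank K (powerSpan f k) := by
  have hle : homogeneousSubmodule (Fin 2) K (d * k + 1) ≤
      (powerSpan f k).map (LinearMap.mulLeft K (X 0)) ⊔
        (powerSpan f k).map (LinearMap.mulLeft K (X 1)) := by
    intro p hp
    obtain ⟨a, ha, b, hb, rfl⟩ := h p hp
    exact Submodule.add_mem_sup ⟨a, ha, rfl⟩ ⟨b, hb, rfl⟩
  have h1 := Submodule.finrank_mono hle
  have h2 := Submodule.finrank_add_le_finrank_add_finrank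
    ((powerSpan f k).map (LinearMap.mulLeft K (X 0)))
    ((powerSpan f k).map (LinearMap.mulLeft K (X 1)))
  have h3 := Submodule.finrank_map_le (LinearMap.mulLeft K (X (0 : Fin 2))) (powerSpan f k)
  have h4 := Submodule.finrank_map_le (LinearMap.mulLeft K (X (1 : Fin 2))) (powerSpan f k)
  rw [finrank_homogeneousSubmodule_two] at h1
  omega

theorem two_mul_choose_two (n : ℕ) : 2 * (n + 2).choose 2 = (n + 2) * (n + 1) := by
  rw [Nat.choose_two_right]
  exact Nat.mul_div_cancel' (Nat.even_mul_pred_self (n + 2)).two_dvd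

/-- The degree of a polynomial relation is at least the least degree of a homogeneous one. -/
theorem le_totalDegree_of_aeval_eq_zero (hd : 0 < d) (hf : ∀ i, (f i).IsHomogeneous d) {e : ℕ}
    (he : ∀ i < e, relations f i = ⊥) {P : MvPolynomial (Fin 3) K} (hP : P ≠ 0)
    (hPf : aeval f P = 0) : e ≤ P.totalDegree := by
  obtain ⟨i, hi⟩ : ∃ i, homogeneousComponent i P ≠ 0 := by
    by_contra! h
    exact hP (eq_zero_of_homogeneousComponent_eq_zero h)
  have hi' : i ≤ P.totalDegree := by
    by_contra! h
    exact hi (homogeneousComponent_eq_zero _ _ h)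
  refine le_trans ?_ hi'
  by_contra! h
  refine hi ?_
  rw [← Submodule.mem_bot K, ← he i h, mem_relations]
  refine ⟨homogeneousComponent_isHomogeneous _ _, ?_⟩
  -- The component of degree `i` is sent to degree `d * i`. These degrees are distinct as `0 < d`,
  -- so each component of a relation is itself a relation.
  have h1 := congrArg (homogeneousComponent (d * i)) hPf
  rw [← sum_homogeneousComponent P, map_sum, map_sum, map_zero,
    Finset.sum_eq_single_of_mem i (by rw [Finset.mem_range]; omega)] at h1
  · rwa [homogeneousComponent_eq_self
      (isHomogeneous_aeval_forms hf (homogeneousComponent_isHomogeneous i P))] at h1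
  · intro j _ hj
    rw [homogeneousComponent_of_mem ((mem_homogeneousSubmodule _ _).2
      (isHomogeneous_aeval_forms hf (homogeneousComponent_isHomogeneous j P))), if_neg]
    exact fun h => hj (Nat.eq_of_mul_eq_mul_left hd h).symm

/-- A relation of least degree is prime. -/
theorem prime_of_mem_relations (hd : 0 < d) (hf : ∀ i, (f i).IsHomogeneous d) {e : ℕ}
    (he : ∀ i < e, relations f i = ⊥) {F : MvPolynomial (Fin 3) K} (hF : F ≠ 0)
    (hFe : F ∈ relations f e) : Prime F := by
  rw [mem_relations] at hFe
  rw [← UniqueFactorizationMonoid.irreducible_iff_prime]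
  -- One factor of `F` must vanish on the forms, as the target is a domain. By minimality it already
  -- has the full degree `e`, so the other factor is constant.
  have key : ∀ P Q : MvPolynomial (Fin 3) K, F = P * Q → aeval f P = 0 → IsUnit Q := by
    intro P Q h hP
    have hP0 : P ≠ 0 := by rintro rfl; simp [h] at hF
    have hQ0 : Q ≠ 0 := by rintro rfl; simp [h] at hF
    have h1 := le_totalDegree_of_aeval_eq_zero hd hf he hP0 hP
    have h2 := totalDegree_mul_of_isDomain hP0 hQ0
    rw [← h, hFe.1.totalDegree hF] at h2
    have h3 := totalDegree_eq_zero_iff_eq_C.1 (show Q.totalDegree = 0 by omega)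
    rw [h3] at hQ0 ⊢
    exact (isUnit_iff_ne_zero.2 fun h => hQ0 (by rw [h, map_zero])).map C
  refine ⟨fun h => ?_, fun P Q h => ?_⟩
  · have := h.map (aeval f)
    rw [hFe.2] at this
    exact not_isUnit_zero this
  · have h1 := hFe.2
    rw [h, map_mul, mul_eq_zero] at h1
    rcases h1 with h1 | h1
    · exact Or.inr (key P Q h h1)
    · exact Or.inl (key Q P (by rw [h, mul_comm]) h1)

theorem map_mulLeft_relations_le {e : ℕ} {F : MvPolynomial (Fin 3) K} (hF : F ∈ relations f e)
    (k : ℕ) : (homogeneousSubmodule (Fin 3) K k).map (LinearMap.mulLeft K F) ≤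
      relations f (e + k) := by
  rintro _ ⟨P, hP, rfl⟩
  rw [mem_relations] at hF ⊢
  refine ⟨hF.1.mul hP, ?_⟩
  rw [LinearMap.mulLeft_apply, map_mul, hF.2, zero_mul]

theorem finrank_map_mulLeft {F : MvPolynomial (Fin 3) K} (hF : F ≠ 0) (k : ℕ) :
    Module.finrank K ((homogeneousSubmodule (Fin 3) K k).map (LinearMap.mulLeft K F)) =
      (k + 2).choose 2 := by
  rw [← (Submodule.equivMapOfInjective (LinearMap.mulLeft K F)
    (fun _ _ h => mul_left_cancel₀ hF h) _).finrank_eq,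
    finrank_homogeneousSubmodule_three]

/-- The cofactor of a form in a form is a form. -/
theorem exists_eq_mul_of_dvd {e k : ℕ} {F G : MvPolynomial (Fin 3) K} (hF : F.IsHomogeneous e)
    (hG : G.IsHomogeneous (e + k)) (h : F ∣ G) : ∃ Q, Q.IsHomogeneous k ∧ G = F * Q := by
  obtain ⟨Q, rfl⟩ := h
  refine ⟨_, homogeneousComponent_isHomogeneous k Q, ?_⟩
  rw [← homogeneousComponent_eq_self hG, mul_comm, add_comm,
    homogeneousComponent_mul_of_isHomogeneous hF, mul_comm]

/-- If the spaces `powerSpan f k` grow without bound, then every relation is a multiple of a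
relation that is prime. -/
theorem dvd_of_mem_relations {e g : ℕ} {F G : MvPolynomial (Fin 3) K} (hF : Prime F)
    (hFe : F ∈ relations f e) (hG : G ∈ relations f g)
    (hV : e * g < Module.finrank K (powerSpan f (e + g + 2 * (e * g)))) : F ∣ G := by
  by_contra hdvd
  have hG0 : G ≠ 0 := by rintro rfl; exact hdvd (dvd_zero _)
  set k := 2 * (e * g) with hk
  -- If `F` does not divide `G`, common multiples are multiples of `G * F`. Inclusion-exclusion then
  -- leaves at most `e * g` dimensions for `V_{e+g+k}`, as in Bézout's theorem, against `hV`.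
  have hinf : (homogeneousSubmodule (Fin 3) K (g + k)).map (LinearMap.mulLeft K F) ⊓
      (homogeneousSubmodule (Fin 3) K (e + k)).map (LinearMap.mulLeft K G) ≤
      (homogeneousSubmodule (Fin 3) K k).map (LinearMap.mulLeft K (G * F)) := by
    rintro _ ⟨⟨P, hP, rfl⟩, ⟨Q, hQ, hPQ⟩⟩
    rw [LinearMap.mulLeft_apply, LinearMap.mulLeft_apply] at hPQ
    obtain ⟨R, hR, rfl⟩ := exists_eq_mul_of_dvd (mem_relations.1 hFe).1 hQ
      ((hF.dvd_or_dvd ⟨P, hPQ⟩).resolve_left hdvd)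
    exact ⟨R, hR, by rw [LinearMap.mulLeft_apply, LinearMap.mulLeft_apply, ← hPQ, mul_assoc]⟩
  have hsup : (homogeneousSubmodule (Fin 3) K (g + k)).map (LinearMap.mulLeft K F) ⊔
      (homogeneousSubmodule (Fin 3) K (e + k)).map (LinearMap.mulLeft K G) ≤
      relations f (e + g + k) := by
    refine sup_le ?_ ?_
    · rw [add_assoc]; exact map_mulLeft_relations_le hFe _
    · rw [add_comm e g, add_assoc]; exact map_mulLeft_relations_le hG _
  have h1 := Submodule.finrank_mono hinf
  have h2 := Submodule.finrank_mono hsup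
  have h3 := Submodule.finrank_sup_add_finrank_inf_eq
    ((homogeneousSubmodule (Fin 3) K (g + k)).map (LinearMap.mulLeft K F))
    ((homogeneousSubmodule (Fin 3) K (e + k)).map (LinearMap.mulLeft K G))
  have h4 := finrank_powerSpan_add f (e + g + k)
  rw [finrank_map_mulLeft (mul_ne_zero hG0 hF.ne_zero)] at h1
  rw [finrank_map_mulLeft hF.ne_zero, finrank_map_mulLeft hG0] at h3
  have c1 := two_mul_choose_two k
  have c2 := two_mul_choose_two (g + k)
  have c3 := two_mul_choose_two (e + k)
  have c4 := two_mul_choose_two (e + g + k)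
  nlinarith

/-- The dimensions of the spaces spanned by products of forms. -/
theorem finrank_powerSpan (hd : 3 ≤ d) (hf : ∀ i, (f i).IsHomogeneous d)
    (hrel : relations f (d - 1) = ⊥) (hfill : FillsNextDegree f d (d - 2)) {k : ℕ}
    (hk : d - 2 ≤ k) : Module.finrank K (powerSpan f k) + (d - 1).choose 2 = d * k + 1 := by
  have hfill' : ∀ l, d - 2 ≤ l → FillsNextDegree f d l := by
    intro l hl
    obtain ⟨m, hm⟩ : ∃ m, d - 2 = m + 1 := ⟨d - 3, by omega⟩
    rw [hm] at hfill hl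
    exact hfill.of_le hf hl
  have hex : ∃ e, relations f e ≠ ⊥ := by
    by_contra! h
    -- Degree `2 * d` contains a relation: `(2 * d + 2).choose 2 = 2 * d ^ 2 + 3 * d + 1` exceeds
    -- the available `2 * d ^ 2 + 1`.
    have h1 := finrank_powerSpan_add f (2 * d)
    have h2 := finrank_powerSpan_le hf (2 * d)
    rw [h, finrank_bot] at h1
    have h3 := two_mul_choose_two (2 * d)
    nlinarith
  classical
  obtain ⟨e, he, hmin⟩ : ∃ e, relations f e ≠ ⊥ ∧ ∀ i < e, relations f i = ⊥ :=
    ⟨Nat.find hex, Nat.find_spec hex, fun i hi => not_not.1 (Nat.find_min hex hi)⟩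
  obtain ⟨F, hFe, hF0⟩ := (Submodule.ne_bot_iff _).1 he
  have hed : d ≤ e := by
    by_contra! h
    have h1 : F * X 0 ^ (d - 1 - e) ∈ relations f (d - 1) := by
      rw [mem_relations] at hFe ⊢
      refine ⟨?_, by rw [map_mul, hFe.2, zero_mul]⟩
      convert hFe.1.mul (isHomogeneous_X_pow (R := K) (0 : Fin 3) (d - 1 - e)) using 1
      omega
    rw [hrel, Submodule.mem_bot] at h1
    exact mul_ne_zero hF0 (pow_ne_zero _ (X_ne_zero _)) h1
  have hprime := prime_of_mem_relations (by omega) hf hmin hF0 hFe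
  have hrelk : ∀ m, Module.finrank K (relations f (e + m)) = (m + 2).choose 2 := by
    intro m
    have hrange : (homogeneousSubmodule (Fin 3) K m).map (LinearMap.mulLeft K F) =
        relations f (e + m) := by
      refine le_antisymm (map_mulLeft_relations_le hFe m) fun G hG => ?_
      have hdvd : F ∣ G := by
        refine dvd_of_mem_relations hprime hFe hG ?_
        have h1 := (hfill' (e + (e + m) + 2 * (e * (e + m))) (by omega)).le_finrank
        nlinarith
      obtain ⟨Q, hQ, rfl⟩ :=
        exists_eq_mul_of_dvd (mem_relations.1 hFe).1 (mem_relations.1 hG).1 hdvd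
      exact ⟨Q, hQ, rfl⟩
    rw [← hrange, finrank_map_mulLeft hF0]
  have hde : e = d := by
    refine le_antisymm ?_ hed
    by_contra! h
    -- In degree `e + m` the dimension of `V` is `e * m + e * (e + 3) / 2`, with slope `e`, while
    -- its upper bound has slope `d`. If `d < e`, then `m = d * e + 1` is large enough to violate
    -- the bound.
    have h1 := finrank_powerSpan_add f (e + (d * e + 1))
    have h2 := finrank_powerSpan_le hf (e + (d * e + 1))
    rw [hrelk] at h1
    have h3 := two_mul_choose_two (d * e + 1)
    have h4 := two_mul_choose_two (e + (d * e + 1))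
    nlinarith
  subst hde
  have h1 := finrank_powerSpan_add f k
  have h3 := two_mul_choose_two k
  obtain ⟨c, rfl⟩ : ∃ c, e = c + 3 := ⟨e - 3, by omega⟩
  have h4 := two_mul_choose_two c
  rw [show c + 3 - 1 = c + 2 by omega]
  rcases Nat.lt_or_ge k (c + 3) with hlt | hge
  · rw [hmin k hlt, finrank_bot] at h1
    -- In degrees `d - 2` and `d - 1` there are no relations yet. The general formula persists
    -- because `(k - d + 2) * (k - d + 1) / 2` vanishes for both values.
    have : k = c + 1 ∨ k = c + 2 := by omega
    rcases this with rfl | rfl <;> nlinarith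
  · obtain ⟨m, rfl⟩ := Nat.exists_eq_add_of_le hge
    rw [hrelk] at h1
    have h5 := two_mul_choose_two m
    nlinarith

end Relations

/-! ### The special triple: absence of low relations, and parameters of the nodes. -/

section PowerForms

/-- The forms `(x + y) ^ d`, `x ^ d`, `y ^ d`. -/
noncomputable def powerForms (d : ℕ) : Fin 3 → MvPolynomial (Fin 2) ℂ :=
  ![(X 0 + X 1) ^ d, X 0 ^ d, X 1 ^ d]

theorem isHomogeneous_powerForms (d : ℕ) (i : Fin 3) : (powerForms d i).IsHomogeneous d := by
  have h : ((X 0 + X 1 : MvPolynomial (Fin 2) ℂ) ^ d).IsHomogeneous (1 * d) :=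
    ((isHomogeneous_X _ _).add (isHomogeneous_X _ _)).pow d
  rw [one_mul] at h
  fin_cases i
  · exact h
  · exact isHomogeneous_X_pow _ _
  · exact isHomogeneous_X_pow _ _

/-- Lets a relation be read as a univariate polynomial in its first variable, whose roots can be
counted. -/
theorem aeval_cons {R S : Type*} [CommRing R] [CommRing S] [Algebra R S]
    {n : ℕ} (a : S) (b : Fin n → S) (P : MvPolynomial (Fin (n + 1)) R) :
    aeval (Fin.cons a b : Fin (n + 1) → S) P =
      ((finSuccEquiv R n P).map (aeval b : MvPolynomial (Fin n) R →ₐ[R] S).toRingHom).eval a := by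
  rw [Polynomial.eval_map]
  have h : (aeval (Fin.cons a b : Fin (n + 1) → S) : MvPolynomial (Fin (n + 1)) R →ₐ[R] S).toRingHom =
      (Polynomial.eval₂RingHom (aeval b : MvPolynomial (Fin n) R →ₐ[R] S).toRingHom a).comp
        (finSuccEquiv R n).toRingEquiv.toRingHom := by
    apply MvPolynomial.ringHom_ext
    · intro r
      simp [finSuccEquiv_apply]
    · intro i
      refine Fin.cases ?_ (fun i => ?_) i
      · simp [finSuccEquiv_X_zero]
      · simp [finSuccEquiv_X_succ]
  exact RingHom.congr_fun h P

theorem aeval_X_pow_injective {d : ℕ} (hd : 0 < d) : Function.Injective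
    (aeval fun i => X i ^ d : MvPolynomial (Fin 2) ℂ →ₐ[ℂ] MvPolynomial (Fin 2) ℂ).toRingHom := by
  have h : (aeval fun i => X i ^ d : MvPolynomial (Fin 2) ℂ →ₐ[ℂ] MvPolynomial (Fin 2) ℂ) =
      expand d := by
    apply MvPolynomial.algHom_ext
    intro i
    rw [aeval_X, expand_X]
  rw [h]
  exact expand_injective hd

/-- Scaling `x` by a `d`-th root of unity fixes `x ^ d` and `y ^ d` and moves only the first form.
-/
theorem aeval_powerForms {d : ℕ} {z : ℂ} (hz : z ^ d = 1) (i : Fin 3) :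
    (aeval ![C z * X 0, X 1] : _ →ₐ[ℂ] MvPolynomial (Fin 2) ℂ) (powerForms d i) =
      (Fin.cons ((C z * X 0 + X 1) ^ d) (fun i => X i ^ d) : Fin 3 → MvPolynomial (Fin 2) ℂ) i := by
  have h : (C z * X 0 : MvPolynomial (Fin 2) ℂ) ^ d = X 0 ^ d := by
    rw [mul_pow, ← C_pow, hz, C_1, one_mul]
  refine Fin.cases ?_ (fun i => ?_) i
  · simp [powerForms]
  · rw [Fin.cons_succ]
    fin_cases i
    · simpa [powerForms] using h
    · simp [powerForms]

theorem card_nthRootsFinset_one {d : ℕ} (hd : 0 < d) :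
    (Polynomial.nthRootsFinset d (1 : ℂ)).card = d :=
  (Complex.isPrimitiveRoot_exp d hd.ne').card_nthRootsFinset

/-- There is no relation of degree less than `d` between `(x + y) ^ d`, `x ^ d` and `y ^ d`. -/
theorem relations_powerForms {d k : ℕ} (hk : k < d) : relations (powerForms d) k = ⊥ := by
  classical
  rw [eq_bot_iff]
  intro P hP
  rw [mem_relations] at hP
  obtain ⟨hP, hPf⟩ := hP
  have hd : 0 < d := by omega
  set q := (finSuccEquiv ℂ 2 P).map 
    (aeval fun i => X i ^ d : MvPolynomial (Fin 2) ℂ →ₐ[ℂ] MvPolynomial (Fin 2) ℂ).toRingHom with hq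
  have hroot : ∀ z : ℂ, z ^ d = 1 → q.eval ((C z * X 0 + X 1) ^ d) = 0 := by
    intro z hz
    have h1 := congrArg (aeval ![C z * X 0, X 1] : _ →ₐ[ℂ] MvPolynomial (Fin 2) ℂ) hPf
    rw [← AlgHom.comp_apply, comp_aeval, map_zero] at h1
    rw [← h1, hq, ← aeval_cons]
    exact congrArg (fun f => aeval f P) (funext fun i => (aeval_powerForms hz i).symm)
  have hinj : Set.InjOn (fun z : ℂ => ((C z * X 0 + X 1) ^ d : MvPolynomial (Fin 2) ℂ))
      (Polynomial.nthRootsFinset d (1 : ℂ)) := by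
    intro z _ w _ h
    -- The point `(-1, z)` is a zero of `z x + y`, and of `w x + y` only if `w = z`.
    have := congrArg (eval ![-1, z]) h
    simp only [map_pow, map_add, map_mul, eval_C, eval_X] at this
    simp [hd.ne'] at this
    exact (pow_eq_zero_iff hd.ne').1 this.symm |> fun h => by linear_combination h
  have hq0 : q = 0 := by
    refine Polynomial.eq_zero_of_natDegree_lt_card_of_eval_eq_zero' q
      ((Polynomial.nthRootsFinset d (1 : ℂ)).image fun z => (C z * X 0 + X 1) ^ d) ?_ ?_
    · intro x hx
      obtain ⟨z, hz, rfl⟩ := Finset.mem_image.1 hx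
      exact hroot z ((Polynomial.mem_nthRootsFinset hd 1).1 hz)
    · rw [Finset.card_image_of_injOn hinj, card_nthRootsFinset_one hd]
      refine lt_of_le_of_lt Polynomial.natDegree_map_le ?_
      rw [natDegree_finSuccEquiv]
      exact ((degreeOf_le_totalDegree _ _).trans hP.totalDegree_le).trans_lt hk
  rw [hq, Polynomial.map_eq_zero_iff (aeval_X_pow_injective hd)] at hq0
  exact (EmbeddingLike.map_eq_zero_iff (f := finSuccEquiv ℂ 2)).1 hq0

theorem eval_smul_of_isHomogeneous {n : ℕ} {p : MvPolynomial (Fin 2) ℂ} (hp : p.IsHomogeneous n)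
    (c : ℂ) (x : Fin 2 → ℂ) : eval (c • x) p = c ^ n * eval x p := by
  rw [eval_eq', eval_eq', Finset.mul_sum]
  refine Finset.sum_congr rfl fun m hm => ?_
  have h : m.degree = n := by
    by_contra h
    exact mem_support_iff.1 hm (hp.coeff_eq_zero h)
  simp only [Pi.smul_apply, smul_eq_mul, mul_pow, Finset.prod_mul_distrib, Finset.prod_pow_eq_pow_sum]
  rw [← h, Finsupp.degree_eq_sum]
  ring

/-- A form of degree `n` in two variables vanishing at more than `n` points is zero. -/
theorem eq_zero_of_eval_eq_zero_of_lt_card {n : ℕ} {p : MvPolynomial (Fin 2) ℂ}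
    (hp : p.IsHomogeneous n) (s : Finset ℂ) (hs : ∀ t ∈ s, eval ![t, 1] p = 0)
    (hcard : n < s.card) : p = 0 := by
  have hev : ∀ t : ℂ, eval ![t, 1] p =
      ((finSuccEquiv ℂ 1 p).map (eval fun _ => 1)).eval t := by
    intro t
    rw [← eval_eq_eval_mv_eval']
    congr 2
    ext i
    fin_cases i <;> rfl
  have h0 : (finSuccEquiv ℂ 1 p).map (eval fun _ => 1) = 0 := by
    refine Polynomial.eq_zero_of_natDegree_lt_card_of_eval_eq_zero' _ s
      (fun t ht => (hev t).symm.trans (hs t ht)) (lt_of_le_of_lt ?_ hcard)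
    refine Polynomial.natDegree_map_le.trans ?_
    rw [natDegree_finSuccEquiv]
    exact (degreeOf_le_totalDegree _ _).trans hp.totalDegree_le
  -- Dehomogenizing sees only the points with `y ≠ 0`; the factor `X 1` disposes of the rest.
  have h1 : X 1 * p = 0 := by
    apply MvPolynomial.funext
    intro x
    rw [map_mul, eval_X, map_zero]
    rcases eq_or_ne (x 1) 0 with hx | hx
    · rw [hx, zero_mul]
    · have hx' : x = x 1 • ![x 0 / x 1, 1] := by
        ext i
        fin_cases i
        · simp [mul_div_cancel₀ _ hx]
        · simp
      rw [hx', eval_smul_of_isHomogeneous hp, hev, h0]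
      simp
  exact (mul_eq_zero.1 h1).resolve_left (X_ne_zero _)

/-- The parameter of the node of the curve parametrized by `(x + y) ^ d`, `x ^ d`, `y ^ d` given by
the `d`-th roots of unity `z` and `w`. -/
noncomputable def nodeParameter (p : ℂ × ℂ) : ℂ := (1 - p.2) / (p.1 - 1)

/-- Let `t` be the parameter, so `z t + w = 1 + t`. Roots of unity have conjugate equal to inverse,
which gives `conj t * w = z t`. Hence `w * (1 + conj t) = 1 + t`, and `t` determines `w`, then `z`.
The condition `z ≠ w` ensures `1 + t ≠ 0`, and `w ≠ 1` ensures `t ≠ 0`. -/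
theorem nodeParameter_injOn {d : ℕ} (hd : 0 < d) :
    Set.InjOn nodeParameter ((Polynomial.nthRootsFinset d (1 : ℂ)).erase 1).offDiag := by
  have key : ∀ z w : ℂ, z ^ d = 1 → w ^ d = 1 → z ≠ 1 → w ≠ 1 →
      (starRingEnd ℂ) (nodeParameter (z, w)) * w = z * nodeParameter (z, w) := by
    intro z w hz hw hz1 hw1
    have hz0 : z ≠ 0 := by rintro rfl; simp [hd.ne'] at hz
    have hw0 : w ≠ 0 := by rintro rfl; simp [hd.ne'] at hw
    have h : ∀ u : ℂ, u ^ d = 1 → (starRingEnd ℂ) u = u⁻¹ := fun u hu =>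
      (Complex.inv_eq_conj (Complex.norm_eq_one_of_pow_eq_one hu hd.ne')).symm
    have h1 : z - 1 ≠ 0 := sub_ne_zero.2 hz1
    have h2 : z⁻¹ - 1 ≠ 0 := by
      rw [sub_ne_zero, Ne, inv_eq_one]
      exact hz1
    have h3 : 1 - z ≠ 0 := sub_ne_zero.2 hz1.symm
    rw [nodeParameter, map_div₀, map_sub, map_sub, map_one, h z hz, h w hw]
    simp only
    have h4 : z⁻¹ - 1 = (1 - z) / z := by field_simp
    rw [h4]
    field_simp
    ring
  rintro ⟨z, w⟩ h ⟨z', w'⟩ h' heq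
  simp only [Finset.coe_offDiag, Set.mem_offDiag, Finset.mem_coe, Finset.mem_erase,
    Polynomial.mem_nthRootsFinset hd] at h h'
  obtain ⟨⟨hz1, hz⟩, ⟨hw1, hw⟩, hzw⟩ := h
  obtain ⟨⟨hz1', hz'⟩, ⟨hw1', hw'⟩, hzw'⟩ := h'
  have e1 := key z w hz hw hz1 hw1
  have e2 := key z' w' hz' hw' hz1' hw1'
  rw [← heq] at e2
  set r := nodeParameter (z, w) with hr
  have e3 : r * (z - 1) = 1 - w := div_mul_cancel₀ _ (sub_ne_zero.2 hz1)
  have e4 : r * (z' - 1) = 1 - w' := by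
    rw [heq]; exact div_mul_cancel₀ _ (sub_ne_zero.2 hz1')
  have hr1 : (1 + r) ≠ 0 := by
    intro h
    exact hzw (by linear_combination -e3 + (z - 1) * h)
  have e5 : w * (1 + (starRingEnd ℂ) r) = 1 + r := by linear_combination e1 + e3
  have e6 : w' * (1 + (starRingEnd ℂ) r) = 1 + r := by linear_combination e2 + e4
  have hne : 1 + (starRingEnd ℂ) r ≠ 0 := by
    intro h
    rw [h, mul_zero] at e5
    exact hr1 e5.symm
  have hww : w = w' := mul_right_cancel₀ hne (e5.trans e6.symm)
  have hr0 : r ≠ 0 := by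
    intro h
    rw [h, zero_mul] at e3
    exact hw1 (by linear_combination e3)
  subst hww
  exact Prod.ext (mul_left_cancel₀ hr0 (by linear_combination e3 - e4)) rfl

end PowerForms

/-! ### The special triple: filling of the next degree. -/

section PowerForms

theorem eval_powerForms_node {d : ℕ} {z w : ℂ} (hz : z ^ d = 1) (hw : w ^ d = 1) (hz1 : z ≠ 1)
    (i : Fin 3) : eval ![z * nodeParameter (z, w), w] (powerForms d i) =
      eval ![nodeParameter (z, w), 1] (powerForms d i) := by
  have h : z * nodeParameter (z, w) + w = nodeParameter (z, w) + 1 := by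
    have : nodeParameter (z, w) * (z - 1) = 1 - w := div_mul_cancel₀ _ (sub_ne_zero.2 hz1)
    linear_combination this
  fin_cases i
  · simp [powerForms, h]
  · simp [powerForms, mul_pow, hz]
  · simp [powerForms, hw]

theorem eval_aeval_forms (f : Fin 3 → MvPolynomial (Fin 2) ℂ) (x : Fin 2 → ℂ)
    (R : MvPolynomial (Fin 3) ℂ) :
    eval x (aeval f R) = eval (fun i => eval x (f i)) R := by
  have h : (eval x).comp (aeval f : MvPolynomial (Fin 3) ℂ →ₐ[ℂ] _).toRingHom =
      eval (fun i => eval x (f i)) := by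
    apply MvPolynomial.ringHom_ext
    · intro r
      simp
    · intro i
      simp
  exact RingHom.congr_fun h R

theorem eval_powerSpan_node {d k : ℕ} {z w : ℂ} (hz : z ^ d = 1) (hw : w ^ d = 1) (hz1 : z ≠ 1)
    {a : MvPolynomial (Fin 2) ℂ} (ha : a ∈ powerSpan (powerForms d) k) :
    eval ![z * nodeParameter (z, w), w] a = eval ![nodeParameter (z, w), 1] a := by
  obtain ⟨P, -, rfl⟩ := mem_powerSpan.1 ha
  rw [eval_aeval_forms, eval_aeval_forms]
  simp only [eval_powerForms_node hz hw hz1]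

/-- There is no linear syzygy in degree `d - 3`: its coefficients would vanish at all the nodes of
the curve parametrized by `(x + y) ^ d`, `x ^ d` and `y ^ d`. -/
theorem eq_zero_of_mem_powerSpan_powerForms {d k : ℕ} (hd : d = k + 3)
    {a b : MvPolynomial (Fin 2) ℂ} (ha : a ∈ powerSpan (powerForms d) k)
    (hb : b ∈ powerSpan (powerForms d) k) (h : X 0 * a + X 1 * b = 0) : a = 0 := by
  classical
  have hd0 : 0 < d := by omega
  have hah := powerSpan_le (isHomogeneous_powerForms d) k ha
  refine eq_zero_of_eval_eq_zero_of_lt_card hah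
    ((((Polynomial.nthRootsFinset d (1 : ℂ)).erase 1).offDiag).image nodeParameter) ?_ ?_
  · intro t ht
    obtain ⟨⟨z, w⟩, hzw, rfl⟩ := Finset.mem_image.1 ht
    simp only [Finset.mem_offDiag, Finset.mem_erase, Polynomial.mem_nthRootsFinset hd0] at hzw
    obtain ⟨⟨hz1, hz⟩, ⟨hw1, hw⟩, hne⟩ := hzw
    have h1 : eval ![nodeParameter (z, w), 1] (X 0 * a + X 1 * b) = 0 := by rw [h, map_zero]
    have h2 : eval ![z * nodeParameter (z, w), w] (X 0 * a + X 1 * b) = 0 := by rw [h, map_zero]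
    rw [map_add, map_mul, map_mul, eval_X, eval_X] at h1 h2
    rw [eval_powerSpan_node hz hw hz1 ha, eval_powerSpan_node hz hw hz1 hb] at h2
    simp only [Matrix.cons_val_zero, Matrix.cons_val_one, one_mul] at h1 h2
    have ht0 : nodeParameter (z, w) ≠ 0 :=
      div_ne_zero (sub_ne_zero.2 hw1.symm) (sub_ne_zero.2 hz1)
    -- Both preimages `(t, 1)` and `(z t, w)` of the node give the same values of `a` and `b`. The
    -- two resulting linear equations in these values have determinant `t * (w - z) ≠ 0`.
    refine (mul_eq_zero.1 (?_ : (nodeParameter (z, w) * (w - z)) * _ = 0)).resolve_left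
      (mul_ne_zero ht0 (sub_ne_zero.2 hne.symm))
    linear_combination w * h1 - h2
  · rw [Finset.card_image_of_injOn (nodeParameter_injOn hd0), Finset.offDiag_card,
      Finset.card_erase_of_mem ((Polynomial.mem_nthRootsFinset hd0 1).2 (one_pow d)),
      card_nthRootsFinset_one hd0, hd, show k + 3 - 1 = k + 2 by omega]
    -- There are `(k + 2) * (k + 1) = d * k + 2` parameters, more than the degree `d * k` of `a`.
    refine Nat.lt_sub_of_add_lt ?_
    nlinarith

/-- The map `(a, b) ↦ x a + y b` on pairs from `V_k` is injective, and source and target have the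
same dimension: `2 * (k + 2).choose 2 = (k + 3) * k + 2`. -/
theorem fillsNextDegree_powerForms_sub_three {d k : ℕ} (hd : d = k + 3) :
    FillsNextDegree (powerForms d) d k := by
  have hpair : ∀ a ∈ powerSpan (powerForms d) k, ∀ b ∈ powerSpan (powerForms d) k,
      X 0 * a + X 1 * b = 0 → a = 0 ∧ b = 0 := by
    intro a ha b hb h
    have h0 := eq_zero_of_mem_powerSpan_powerForms hd ha hb h
    refine ⟨h0, ?_⟩
    rw [h0, mul_zero, zero_add] at h
    exact (mul_eq_zero.1 h).resolve_left (X_ne_zero _)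
  let L := (powerSpan (powerForms d) k).prod (powerSpan (powerForms d) k)
  let μ : MvPolynomial (Fin 2) ℂ × MvPolynomial (Fin 2) ℂ →ₗ[ℂ] MvPolynomial (Fin 2) ℂ :=
    LinearMap.coprod (LinearMap.mulLeft ℂ (X 0)) (LinearMap.mulLeft ℂ (X 1))
  have hμ : ∀ a b, μ (a, b) = X 0 * a + X 1 * b := fun a b => by simp [μ]
  have hL : Module.Finite ℂ L := Module.Finite.equiv (submoduleProdEquiv _ _).symm
  have h1 := finrank_map_add_finrank_inf_ker μ L
  have hbot : L ⊓ LinearMap.ker μ = ⊥ := by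
    rw [eq_bot_iff]
    rintro ⟨a, b⟩ ⟨⟨ha, hb⟩, h⟩
    rw [SetLike.mem_coe, LinearMap.mem_ker, hμ] at h
    obtain ⟨rfl, rfl⟩ := hpair a ha b hb h
    exact Submodule.zero_mem _
  have hle : L.map μ ≤ homogeneousSubmodule (Fin 2) ℂ (d * k + 1) := by
    rintro _ ⟨⟨a, b⟩, ⟨ha, hb⟩, rfl⟩
    rw [hμ, add_comm (d * k)]
    exact ((isHomogeneous_X _ _).mul (powerSpan_le (isHomogeneous_powerForms d) k ha)).add
      ((isHomogeneous_X _ _).mul (powerSpan_le (isHomogeneous_powerForms d) k hb))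
  have h2 := finrank_powerSpan_add (powerForms d) k
  rw [relations_powerForms (by omega), finrank_bot] at h2
  rw [hbot, finrank_bot, (submoduleProdEquiv _ _).finrank_eq, Module.finrank_prod] at h1
  have h3 := two_mul_choose_two k
  have heq := Submodule.eq_of_le_of_finrank_eq hle (by
    rw [finrank_homogeneousSubmodule_two]
    subst hd
    nlinarith)
  intro p hp
  obtain ⟨⟨a, b⟩, ⟨ha, hb⟩, hab⟩ := heq.ge hp
  exact ⟨a, ha, b, hb, by rw [← hab, hμ]⟩

/-- The ideal generated by `(x + y) ^ d`, `x ^ d` and `y ^ d` contains all forms of degree at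
least `2 * d - 2`. -/
theorem mem_span_powerForms {d n : ℕ} (hd : 2 ≤ d) (hn : 2 * d ≤ n + 2)
    {p : MvPolynomial (Fin 2) ℂ} (hp : p.IsHomogeneous n) :
    p ∈ Ideal.span (Set.range (powerForms d)) := by
  have hmem : ∀ i, powerForms d i ∈ Ideal.span (Set.range (powerForms d)) := fun i =>
    Ideal.subset_span ⟨i, rfl⟩
  have hX0 : ∀ i j, d ≤ i → (X 0 ^ i * X 1 ^ j : MvPolynomial (Fin 2) ℂ) ∈
      Ideal.span (Set.range (powerForms d)) := by
    intro i j h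
    rw [← Nat.sub_add_cancel h, pow_add]
    exact Ideal.mul_mem_right _ _ (Ideal.mul_mem_left _ _ (hmem 1))
  have hX1 : ∀ i j, d ≤ j → (X 0 ^ i * X 1 ^ j : MvPolynomial (Fin 2) ℂ) ∈
      Ideal.span (Set.range (powerForms d)) := by
    intro i j h
    rw [← Nat.sub_add_cancel h, pow_add]
    exact Ideal.mul_mem_left _ _ (Ideal.mul_mem_left _ _ (hmem 2))
  have hmid : (X 0 ^ (d - 1) * X 1 ^ (d - 1) : MvPolynomial (Fin 2) ℂ) ∈
      Ideal.span (Set.range (powerForms d)) := by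
    -- In this product only the term `d * x ^ (d - 1) * y ^ (d - 1)` has both exponents below `d`;
    -- its coefficient is invertible.
    have h1 : (X 0 + X 1) ^ d * X 0 ^ (d - 2) ∈ Ideal.span (Set.range (powerForms d)) :=
      Ideal.mul_mem_right _ _ (hmem 0)
    rw [add_pow, Finset.sum_mul] at h1
    have h1m : 1 ∈ Finset.range (d + 1) := by rw [Finset.mem_range]; omega
    rw [← Finset.add_sum_erase _ _ h1m] at h1
    have h2 : ∑ i ∈ (Finset.range (d + 1)).erase 1,
        (X 0 ^ i * X 1 ^ (d - i) * (d.choose i : MvPolynomial (Fin 2) ℂ) * X 0 ^ (d - 2)) ∈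
        Ideal.span (Set.range (powerForms d)) := by
      refine Ideal.sum_mem _ fun i hi => ?_
      have e : (X 0 ^ i * X 1 ^ (d - i) * (d.choose i : MvPolynomial (Fin 2) ℂ) * X 0 ^ (d - 2)) =
        (d.choose i : MvPolynomial (Fin 2) ℂ) * (X 0 ^ (i + (d - 2)) * X 1 ^ (d - i)) := by ring
      rw [e]
      refine Ideal.mul_mem_left _ _ ?_
      have hi1 := Finset.ne_of_mem_erase hi
      rcases Nat.lt_or_ge i 1 with h | h
      · exact hX1 _ _ (by omega)
      · exact hX0 _ _ (by omega)
    have h3 := (Ideal.add_mem_iff_left _ h2).1 h1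
    have h4 := Ideal.mul_mem_left _ (C (d : ℂ)⁻¹) h3
    convert h4 using 1
    have hd0 : (d : ℂ) ≠ 0 := by exact_mod_cast (by omega : d ≠ 0)
    have e1 : (C (d : ℂ)⁻¹ : MvPolynomial (Fin 2) ℂ) * (d : MvPolynomial (Fin 2) ℂ) = 1 := by
      rw [← map_natCast (C : ℂ →+* MvPolynomial (Fin 2) ℂ), ← C_mul, inv_mul_cancel₀ hd0, C_1]
    rw [Nat.choose_one_right, show d - 1 = 1 + (d - 2) by omega, pow_add (X 0), pow_one]
    linear_combination (-(X 0 * X 0 ^ (d - 2) * X 1 ^ (1 + (d - 2)))) * e1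
  rw [as_sum p]
  refine Ideal.sum_mem _ fun m hm => ?_
  have hm' : m.degree = n := by
    by_contra h
    exact mem_support_iff.1 hm (hp.coeff_eq_zero h)
  rw [Finsupp.degree_eq_sum, Fin.sum_univ_two] at hm'
  rw [monomial_eq, Finsupp.prod_fintype _ _ (by simp), Fin.prod_univ_two]
  refine Ideal.mul_mem_left _ _ ?_
  by_cases h0 : d ≤ m 0
  · exact hX0 _ _ h0
  by_cases h1 : d ≤ m 1
  · exact hX1 _ _ h1
  rw [show m 0 = d - 1 by omega, show m 1 = d - 1 by omega]
  exact hmid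

/-- For `d = 3` the exponent `d - 3` is zero, where filling says nothing about the ideal of the
forms. So this one step uses the explicit bound `2 * d - 2 ≤ d * (d - 2) + 1`. -/
theorem fillsNextDegree_powerForms {d : ℕ} (hd : 3 ≤ d) :
    FillsNextDegree (powerForms d) d (d - 2) := by
  obtain ⟨k, rfl⟩ : ∃ k, d = k + 3 := ⟨d - 3, by omega⟩
  refine (fillsNextDegree_powerForms_sub_three rfl).succ_of_mem_span (isHomogeneous_powerForms _)
    fun p hp => mem_span_powerForms (by omega) ?_ hp
  nlinarith

end PowerForms

/-! ### Semicontinuity of ranks in the coefficients of the forms. -/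

section Semicontinuity

variable {K : Type} [Field K] {r d : ℕ}

/-- Evaluation of a polynomial in the coefficients of `r` forms. -/
noncomputable def evalCoeffs (f : Fin r → homogeneousSubmodule (Fin 2) K d) :
    MvPolynomial (Fin r × {m : Fin 2 →₀ ℕ // m.degree = d}) K →+* K :=
  eval fun v => coeff v.2.1 (f v.1 : MvPolynomial (Fin 2) K)

instance finite_degree_eq {σ : Type*} [Finite σ] (n : ℕ) :
    Finite {m : σ →₀ ℕ // m.degree = n} := by
  classical
  have := Fintype.ofFinite σ
  exact Finite.of_equiv (Sym σ n) ((Equiv.subtypeEquivRight fun m => by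
    simp [Finsupp.degree_eq_sum, Finsupp.sum_fintype]).trans (Sym.equivNatSum σ n).symm).symm

/-- The `i`-th of `r` forms of degree `d` with indeterminate coefficients. -/
noncomputable def genericForm (K : Type) [Field K] (r d : ℕ) (i : Fin r) :
    MvPolynomial (Fin 2) (MvPolynomial (Fin r × {m : Fin 2 →₀ ℕ // m.degree = d}) K) :=
  ∑ᶠ m : {m : Fin 2 →₀ ℕ // m.degree = d}, monomial m.1 (X (i, m))

theorem map_genericForm (f : Fin r → homogeneousSubmodule (Fin 2) K d) (i : Fin r) :
    map (evalCoeffs f) (genericForm K r d i) = (f i : MvPolynomial (Fin 2) K) := by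
  classical
  have := Fintype.ofFinite {m : Fin 2 →₀ ℕ // m.degree = d}
  rw [genericForm, finsum_eq_sum_of_fintype, map_sum]
  simp only [map_monomial, evalCoeffs, eval_X]
  ext n
  rw [coeff_sum]
  simp only [coeff_monomial]
  by_cases hn : n.degree = d
  · rw [Finset.sum_eq_single_of_mem ⟨n, hn⟩ (Finset.mem_univ _)]
    · rw [if_pos rfl]
    · intro m _ hm
      rw [if_neg]
      exact fun h => hm (Subtype.ext h)
  · rw [IsHomogeneous.coeff_eq_zero (f i).2 hn]
    refine Finset.sum_eq_zero fun m _ => ?_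
    rw [if_neg]
    rintro rfl
    exact hn m.2

/-- Linear independence of vectors that depend polynomially on the coefficients of forms is an open
condition. -/
theorem exists_polynomial_linearIndependent {J : Type*} [Finite J]
    (v : J → MvPolynomial (Fin 2)
      (MvPolynomial (Fin r × {m : Fin 2 →₀ ℕ // m.degree = d}) K))
    (f₀ : Fin r → homogeneousSubmodule (Fin 2) K d)
    (h : LinearIndependent K fun j => map (evalCoeffs f₀) (v j)) :
    ∃ p, evalCoeffs f₀ p ≠ 0 ∧ ∀ f, evalCoeffs f p ≠ 0 →
      LinearIndependent K fun j => map (evalCoeffs f) (v j) := by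
  classical
  have := Fintype.ofFinite J
  -- Coordinates adapted to `f₀` replace the choice of a minor: composing the vectors with `L` gives
  -- a square matrix `M` with polynomial entries, equal to the identity at `f₀`. The required
  -- polynomial is its determinant.
  obtain ⟨L, hL⟩ := LinearMap.exists_leftInverse_of_injective _ (LinearMap.ker_eq_bot.2 h)
  let M : Matrix J J (MvPolynomial (Fin r × {m : Fin 2 →₀ ℕ // m.degree = d}) K) :=
    Matrix.of fun i j => ∑ m ∈ (v j).support, coeff m (v j) * C (L (monomial m 1) i)
  have hM : ∀ f, (evalCoeffs f).mapMatrix M =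
      Matrix.of fun i j => L (map (evalCoeffs f) (v j)) i := by
    intro f
    ext i j
    have h1 : map (evalCoeffs f) (v j) =
        ∑ m ∈ (v j).support, evalCoeffs f (coeff m (v j)) • monomial m (1 : K) := by
      conv_lhs => rw [as_sum (v j), map_sum]
      refine Finset.sum_congr rfl fun m _ => ?_
      rw [map_monomial, smul_monomial, smul_eq_mul, mul_one]
    have h2 : M i j = ∑ m ∈ (v j).support, coeff m (v j) * C (L (monomial m 1) i) := rfl
    rw [RingHom.mapMatrix_apply, Matrix.map_apply, h2, Matrix.of_apply, h1, map_sum,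
      map_sum, Finsupp.finsetSum_apply]
    refine Finset.sum_congr rfl fun m _ => ?_
    rw [map_smul, Finsupp.smul_apply, smul_eq_mul, map_mul, evalCoeffs, eval_C]
  refine ⟨M.det, ?_, fun f hf => ?_⟩
  · rw [RingHom.map_det, hM]
    have h1 : (Matrix.of fun i j => L (map (evalCoeffs f₀) (v j)) i) = (1 : Matrix J J K) := by
      ext i j
      have h2 := LinearMap.congr_fun hL (Finsupp.single j 1)
      rw [LinearMap.comp_apply, Finsupp.linearCombination_single, one_smul, LinearMap.id_apply]
        at h2
      rw [Matrix.of_apply, h2, Finsupp.single_apply, Matrix.one_apply]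
      simp [eq_comm]
    rw [h1, Matrix.det_one]
    exact one_ne_zero
  · rw [RingHom.map_det, hM] at hf
    rw [Fintype.linearIndependent_iff]
    intro c hc
    have h1 := Matrix.eq_zero_of_mulVec_eq_zero hf (v := c) (by
      ext i
      have h2 := congrArg (fun w => L w i) hc
      simp only [map_sum, map_smul, map_zero, Finsupp.finsetSum_apply, Finsupp.smul_apply,
        smul_eq_mul, Finsupp.zero_apply] at h2
      rw [Pi.zero_apply, ← h2]
      exact Finset.sum_congr rfl fun j _ => mul_comm _ _)
    exact congrFun h1

/-- The dimension of the span of vectors that depend polynomially on the coefficients of forms is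
lower semicontinuous. -/
theorem exists_polynomial_finrank_span_le {J : Type*} [Finite J]
    (v : J → MvPolynomial (Fin 2)
      (MvPolynomial (Fin r × {m : Fin 2 →₀ ℕ // m.degree = d}) K))
    (f₀ : Fin r → homogeneousSubmodule (Fin 2) K d) :
    ∃ p, evalCoeffs f₀ p ≠ 0 ∧ ∀ f, evalCoeffs f p ≠ 0 →
      Module.finrank K (Submodule.span K (Set.range fun j => map (evalCoeffs f₀) (v j))) ≤
        Module.finrank K (Submodule.span K (Set.range fun j => map (evalCoeffs f) (v j))) := by
  obtain ⟨κ, a, ha, hspan, hli⟩ :=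
    exists_linearIndependent' K fun j => map (evalCoeffs f₀) (v j)
  have hκ : Finite κ := Finite.of_injective a ha
  have := Fintype.ofFinite κ
  obtain ⟨p, hp, hp'⟩ := exists_polynomial_linearIndependent (fun i => v (a i)) f₀ hli
  refine ⟨p, hp, fun f hf => ?_⟩
  have h1 : Module.finrank K (Submodule.span K (Set.range fun j => map (evalCoeffs f₀) (v j))) =
      Fintype.card κ := by
    rw [← hspan]
    exact finrank_span_eq_card hli
  rw [h1, ← finrank_span_eq_card (hp' f hf)]
  have hfin : Module.Finite K (Submodule.span K (Set.range fun j => map (evalCoeffs f) (v j))) :=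
    Module.Finite.span_of_finite K (Set.finite_range _)
  refine Submodule.finrank_mono (Submodule.span_mono ?_)
  rintro _ ⟨i, rfl⟩
  exact ⟨a i, rfl⟩

end Semicontinuity

/-! ### Openness of the two genericity conditions. -/

section Genericity

variable {K : Type} [Field K] {d : ℕ}

theorem powerSpan_eq_span (f : Fin 3 → MvPolynomial (Fin 2) K) (k : ℕ) :
    powerSpan f k = Submodule.span K
      (Set.range fun m : {m : Fin 3 →₀ ℕ // m.degree = k} => ∏ i, f i ^ m.1 i) := by
  apply le_antisymm
  · intro p hp
    obtain ⟨P, hP, rfl⟩ := mem_powerSpan.1 hp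
    rw [aeval_def, eval₂_eq']
    refine Submodule.sum_mem _ fun m hm => ?_
    rw [← Algebra.smul_def]
    refine Submodule.smul_mem _ _ (Submodule.subset_span ⟨⟨m, ?_⟩, rfl⟩)
    by_contra h
    exact mem_support_iff.1 hm (hP.coeff_eq_zero h)
  · rw [Submodule.span_le]
    rintro _ ⟨m, rfl⟩
    refine mem_powerSpan.2 ⟨monomial m.1 1, isHomogeneous_monomial _ m.2, ?_⟩
    rw [aeval_monomial, map_one, one_mul, Finsupp.prod_fintype _ _ (by simp)]

/-- The span of the products of `k` of the forms `f` and a variable. -/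
noncomputable def nextDegreeSpan (f : Fin 3 → MvPolynomial (Fin 2) K) (k : ℕ) :
    Submodule K (MvPolynomial (Fin 2) K) :=
  Submodule.span K (Set.range fun v : Fin 2 × {m : Fin 3 →₀ ℕ // m.degree = k} =>
    X v.1 * ∏ i, f i ^ v.2.1 i)

theorem mem_nextDegreeSpan {f : Fin 3 → MvPolynomial (Fin 2) K} {k : ℕ}
    {p : MvPolynomial (Fin 2) K} : p ∈ nextDegreeSpan f k ↔
      ∃ a ∈ powerSpan f k, ∃ b ∈ powerSpan f k, p = X 0 * a + X 1 * b := by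
  constructor
  · intro hp
    induction hp using Submodule.span_induction with
    | mem p hp =>
      obtain ⟨⟨i, m⟩, rfl⟩ := hp
      have hm : ∏ i, f i ^ m.1 i ∈ powerSpan f k := by
        rw [powerSpan_eq_span]
        exact Submodule.subset_span ⟨m, rfl⟩
      fin_cases i
      · exact ⟨_, hm, 0, zero_mem _, by simp⟩
      · exact ⟨0, zero_mem _, _, hm, by simp⟩
    | zero => exact ⟨0, zero_mem _, 0, zero_mem _, by simp⟩
    | add p q _ _ hp hq =>
      obtain ⟨a, ha, b, hb, rfl⟩ := hp
      obtain ⟨a', ha', b', hb', rfl⟩ := hq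
      exact ⟨_, add_mem ha ha', _, add_mem hb hb', by ring⟩
    | smul c p _ hp =>
      obtain ⟨a, ha, b, hb, rfl⟩ := hp
      exact ⟨_, Submodule.smul_mem _ c ha, _, Submodule.smul_mem _ c hb, by
        rw [smul_add, mul_smul_comm, mul_smul_comm]⟩
  · rintro ⟨a, ha, b, hb, rfl⟩
    have h : ∀ (i : Fin 2), ∀ c ∈ powerSpan f k, X i * c ∈ nextDegreeSpan f k := by
      intro i c hc
      rw [powerSpan_eq_span] at hc
      induction hc using Submodule.span_induction with
      | mem p hp =>
        obtain ⟨m, rfl⟩ := hp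
        exact Submodule.subset_span ⟨(i, m), rfl⟩
      | zero => rw [mul_zero]; exact zero_mem _
      | add p q _ _ hp hq => rw [mul_add]; exact add_mem hp hq
      | smul c p _ hp => rw [mul_smul_comm]; exact Submodule.smul_mem _ _ hp
    exact add_mem (h 0 a ha) (h 1 b hb)

theorem fillsNextDegree_iff_finrank {f : Fin 3 → MvPolynomial (Fin 2) K}
    (hf : ∀ i, (f i).IsHomogeneous d) {k : ℕ} :
    FillsNextDegree f d k ↔ d * k + 2 ≤ Module.finrank K (nextDegreeSpan f k) := by
  have hle : nextDegreeSpan f k ≤ homogeneousSubmodule (Fin 2) K (d * k + 1) := by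
    intro p hp
    obtain ⟨a, ha, b, hb, rfl⟩ := mem_nextDegreeSpan.1 hp
    rw [add_comm (d * k)]
    exact ((isHomogeneous_X _ _).mul (powerSpan_le hf k ha)).add
      ((isHomogeneous_X _ _).mul (powerSpan_le hf k hb))
  have hfill : FillsNextDegree f d k ↔
      homogeneousSubmodule (Fin 2) K (d * k + 1) ≤ nextDegreeSpan f k :=
    forall_congr' fun p => imp_congr Iff.rfl mem_nextDegreeSpan.symm
  have hrank := finrank_homogeneousSubmodule_two (K := K) (d * k + 1)
  rw [hfill]
  constructor
  · intro h
    rw [le_antisymm hle h, hrank]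
  · intro h
    exact (Submodule.eq_of_le_of_finrank_le hle (by omega)).ge

/-- Three forms of degree `d` that are generic as far as the Hilbert function of the powers of the
ideal they generate is concerned. -/
def IsGenericTriple (f : Fin 3 → MvPolynomial (Fin 2) K) (d : ℕ) : Prop :=
  relations f (d - 1) = ⊥ ∧ FillsNextDegree f d (d - 2)

/-- Absence of relations means that `V_{d-1}` has its maximal dimension, and filling is a lower
bound for `nextDegreeSpan`. Each survives where a polynomial is nonzero, and the product of the two
polynomials serves both. -/
theorem exists_polynomial_isGenericTriple {f₀ : Fin 3 → homogeneousSubmodule (Fin 2) K d}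
    (h₀ : IsGenericTriple (fun i => (f₀ i : MvPolynomial (Fin 2) K)) d) :
    ∃ p, evalCoeffs f₀ p ≠ 0 ∧ ∀ f, evalCoeffs f p ≠ 0 →
      IsGenericTriple (fun i => (f i : MvPolynomial (Fin 2) K)) d := by
  obtain ⟨p, hp, hp'⟩ := exists_polynomial_finrank_span_le
    (fun m : {m : Fin 3 →₀ ℕ // m.degree = d - 1} => ∏ i, genericForm K 3 d i ^ m.1 i) f₀
  obtain ⟨q, hq, hq'⟩ := exists_polynomial_finrank_span_le
    (fun v : Fin 2 × {m : Fin 3 →₀ ℕ // m.degree = d - 2} =>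
      X v.1 * ∏ i, genericForm K 3 d i ^ v.2.1 i) f₀
  refine ⟨p * q, ?_, fun f hf => ?_⟩
  · rw [map_mul]
    exact mul_ne_zero hp hq
  rw [map_mul] at hf
  have h1 := hp' f (left_ne_zero_of_mul hf)
  have h2 := hq' f (right_ne_zero_of_mul hf)
  have e1 : ∀ f : Fin 3 → homogeneousSubmodule (Fin 2) K d,
      (fun m : {m : Fin 3 →₀ ℕ // m.degree = d - 1} =>
        map (evalCoeffs f) (∏ i, genericForm K 3 d i ^ m.1 i)) =
      fun m => ∏ i, (f i : MvPolynomial (Fin 2) K) ^ m.1 i := fun f => by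
    simp only [map_prod, map_pow, map_genericForm]
  have e2 : ∀ f : Fin 3 → homogeneousSubmodule (Fin 2) K d,
      (fun v : Fin 2 × {m : Fin 3 →₀ ℕ // m.degree = d - 2} =>
        map (evalCoeffs f) (X v.1 * ∏ i, genericForm K 3 d i ^ v.2.1 i)) =
      fun v => X v.1 * ∏ i, (f i : MvPolynomial (Fin 2) K) ^ v.2.1 i := fun f => by
    simp only [map_prod, map_pow, map_genericForm, map_mul, map_X]
  rw [e1, e1, ← powerSpan_eq_span, ← powerSpan_eq_span] at h1
  rw [e2, e2] at h2
  constructor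
  · have e1 := finrank_powerSpan_add (fun i => (f₀ i : MvPolynomial (Fin 2) K)) (d - 1)
    have e2 := finrank_powerSpan_add (fun i => (f i : MvPolynomial (Fin 2) K)) (d - 1)
    rw [h₀.1, finrank_bot] at e1
    exact Submodule.finrank_eq_zero.1 (by omega)
  · rw [fillsNextDegree_iff_finrank fun i => (f i).2]
    exact ((fillsNextDegree_iff_finrank fun i => (f₀ i).2).1 h₀.2).trans h2

end Genericity

/-! ### The theorem for generic triples and its assembly. -/

section Main

theorem isGenericTriple_powerForms {d : ℕ} (hd : 3 ≤ d) : IsGenericTriple (powerForms d) d :=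
  ⟨relations_powerForms (by omega), fillsNextDegree_powerForms hd⟩

/-- The Hilbert series and the Betti numbers of the quotient by a power of the ideal generated by a
generic triple of forms. -/
theorem IsGenericTriple.hilbertSeries_and_betti {K : Type} [Field K] {d : ℕ} (hd : 3 ≤ d)
    {f : Fin 3 → MvPolynomial (Fin 2) K} (hf : ∀ i, (f i).IsHomogeneous d)
    (hgen : IsGenericTriple f d) {k : ℕ} (hk : d - 2 ≤ k) :
    ∃ r, r + (d - 1).choose 2 = d * k + 1 ∧
      hilbertSeries (Ideal.span (Set.range f) ^ k) =
        ∑ i ∈ Finset.range (d * k), ((i : PowerSeries ℤ) + 1) * PowerSeries.X ^ i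
          + ((d - 1).choose 2 : PowerSeries ℤ) * PowerSeries.X ^ (d * k) ∧
      HasGradedBettiNumbers (Ideal.span (Set.range f) ^ k) fun i j =>
        if i = 0 ∧ j = 0 then 1 else if i = 1 ∧ j = d * k then r else
        if i = 2 then if j = d * k + 1 then 2 * r - (d * k + 2) else
          if j = d * k + 2 then d * k + 1 - r else 0
        else 0 := by
  obtain ⟨hrel, hfill⟩ := hgen
  have hr := finrank_powerSpan hd hf hrel hfill hk
  have hfill' : FillsNextDegree f d k := by
    obtain ⟨m, hm⟩ : ∃ m, d - 2 = m + 1 := ⟨d - 3, by omega⟩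
    rw [hm] at hfill hk
    exact hfill.of_le hf hk
  obtain ⟨r, hr'⟩ : ∃ r, Module.finrank K (powerSpan f k) = r := ⟨_, rfl⟩
  rw [hr'] at hr
  -- The products themselves may be dependent, so a basis of `V_k` is taken as the minimal set of
  -- generators.
  let b := Module.finBasisOfFinrankEq K (powerSpan f k) hr'
  let g : Fin r → MvPolynomial (Fin 2) K := fun i => (b i).1
  have hspan : Submodule.span K (Set.range g) = powerSpan f k := by
    have h1 := congrArg (Submodule.map (powerSpan f k).subtype) b.span_eq
    rw [Submodule.map_span, ← Set.range_comp, Submodule.map_subtype_top] at h1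
    exact h1
  have hli : LinearIndependent K g :=
    b.linearIndependent.map' (powerSpan f k).subtype (Submodule.ker_subtype _)
  have hg : ∀ i, (g i).IsHomogeneous (d * k) := fun i => powerSpan_le hf k (b i).2
  have hI : Ideal.span (Set.range f) ^ k = Ideal.span (Set.range g) := by
    rw [span_pow_eq_span_powerSpan, ← hspan]
    apply le_antisymm
    · rw [Ideal.span_le]
      exact Submodule.span_le_restrictScalars K (MvPolynomial (Fin 2) K) (Set.range g)
    · exact Ideal.span_mono Submodule.subset_span
  have hfill'' : ∀ p : MvPolynomial (Fin 2) K, p.IsHomogeneous (d * k + 1) →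
      ∃ a ∈ Submodule.span K (Set.range g), ∃ b ∈ Submodule.span K (Set.range g),
        p = X 0 * a + X 1 * b := by
    rw [hspan]
    exact hfill'
  rw [hI]
  have hpos : 0 < d * k := Nat.mul_pos (by omega) (by omega)
  exact ⟨_, hr, hilbertSeries_span hg hli hfill'' hr,
    hasGradedBettiNumbers_span hpos hg hli hfill''⟩

theorem theorem2p6 (d : ℕ) (hd : 3 ≤ d) :
    ∃ U : Set (Fin 3 → homogeneousSubmodule (Fin 2) ℂ d), IsZariskiOpen U ∧ U.Nonempty ∧
      ∀ f ∈ U, ∀ k : ℕ, d - 2 ≤ k → ∀ I : Ideal (MvPolynomial (Fin 2) ℂ),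
        I = Ideal.span (Set.range fun i => (f i : MvPolynomial (Fin 2) ℂ)) →
        hilbertSeries (I ^ k) =
            ∑ i ∈ Finset.range (d * k), ((i : PowerSeries ℤ) + 1) * PowerSeries.X ^ i
              + ((d - 1).choose 2 : PowerSeries ℤ) * PowerSeries.X ^ (d * k) ∧
        ∃ β : ℕ → ℕ → ℕ, HasGradedBettiNumbers (I ^ k) β ∧
          β 0 0 = 1 ∧
          (β 1 (d * k) : ℚ) = (2 * d * k - d ^ 2 + 3 * d) / 2 ∧
          (β 2 (d * k + 1) : ℤ) = d * k - d ^ 2 + 3 * d - 2 ∧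
          β 2 (d * k + 2) = (d - 1).choose 2 ∧
          ∀ i j, (i, j) ≠ (0, 0) → (i, j) ≠ (1, d * k) → (i, j) ≠ (2, d * k + 1) →
            (i, j) ≠ (2, d * k + 2) → β i j = 0 := by
  obtain ⟨p, hp, hU⟩ := exists_polynomial_isGenericTriple
    (f₀ := fun i => ⟨powerForms d i, isHomogeneous_powerForms d i⟩)
    (isGenericTriple_powerForms hd)
  refine ⟨{f | evalCoeffs f p ≠ 0}, ⟨{p}, by simp [evalCoeffs]⟩, ⟨_, hp⟩, ?_⟩
  rintro f hf k hk _ rfl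
  obtain ⟨r, hr, hH, hB⟩ := (hU f hf).hilbertSeries_and_betti hd (fun i => (f i).2) hk
  refine ⟨hH, _, hB, by simp, ?_, ?_, ?_, ?_⟩
  · obtain ⟨c, rfl⟩ : ∃ c, d = c + 3 := ⟨d - 3, by omega⟩
    have h1 := two_mul_choose_two c
    rw [show c + 3 - 1 = c + 2 by omega] at hr
    have h2 : 2 * (r : ℚ) + (c + 2) * (c + 1) = 2 * ((c + 3) * k + 1) := by
      exact_mod_cast (by omega : 2 * r + (c + 2) * (c + 1) = 2 * ((c + 3) * k + 1))
    simp only [one_ne_zero, false_and, if_false, and_self, if_true]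
    push_cast
    linear_combination h2 / 2
  · obtain ⟨c, rfl⟩ : ∃ c, d = c + 3 := ⟨d - 3, by omega⟩
    have h1 := two_mul_choose_two c
    rw [show c + 3 - 1 = c + 2 by omega] at hr
    have h2 : 2 * r + (c + 2) * (c + 1) = 2 * ((c + 3) * k + 1) := by omega
    -- This makes the truncated subtraction in the Betti number exact. It amounts to `(d - 1) * (d -
    -- 2) ≤ d * k`, where `d - 2 ≤ k` enters.
    have h3 : (c + 3) * k + 2 ≤ 2 * r := by
      have : c + 1 ≤ k := by omega
      nlinarith
    have h4 : 2 * (r : ℤ) + (c + 2) * (c + 1) = 2 * ((c + 3) * k + 1) := by exact_mod_cast h2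
    simp only [OfNat.ofNat_ne_zero, OfNat.ofNat_ne_one, false_and, if_false, if_true]
    rw [Nat.cast_sub h3]
    push_cast
    linear_combination h4
  · simp only [OfNat.ofNat_ne_zero, OfNat.ofNat_ne_one, false_and, if_false, if_true]
    rw [if_neg (by omega)]
    omega
  · intro i j h0 h1 h2 h3
    simp only [ne_eq, Prod.mk.injEq] at h0 h1 h2 h3
    rw [if_neg h0, if_neg h1]
    split_ifs with hi hj hj
    · exact absurd ⟨hi, hj⟩ h2
    · exact absurd ⟨hi, hj⟩ h3
    · rfl
    · rfl

end Main
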